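/- Let $n\ge 0$, let $\mathcal C_n=\mathrm{Sp}(2n,\mathbb F_2)$, and for $v\in\mathbb F_2^{2n}$ let $\hat O(v)=\bigotimes_{j=1}^n \hat O(v_jv_{n+j})$ be the $n$-qubit Pauli operator with $\hat O(00)=I$, $\hat O(10)=X$, $\hat O(01)=Z$, $\hat O(11)=Y$. Let $\mathfrak C_n$ be the $n$-qubit unitary Clifford group modulo overall phases: the unitaries $\hat U\in U(2^n)$ for which there is $U\in\mathcal C_n$ with $\hat U\hat O(v)\hat U^\dagger=\pm\hat O(Uv)$ for all $v$ (this $U$ is unique, and is called the tableau of $\hat U$). A probability distribution $\mu$ on $\mathfrak C_n$ is a unitary 2-design if for all complex $2^n\times2^n$ matrices $A,B$ $$\sum_{\hat U\in\mathfrak C_n}\mu(\hat U)\,(\hat U^\dagger A\hat U)\otimes(\hat U^\dagger B\hat U)=\int_{U(2^n)}(\hat U^\dagger A\hat U)\otimes(\hat U^\dagger B\hat U)\,d\hat U \quad\text{(Haar)}.$$ It is Pauli-invariant if $\mu(\hat U)=\mu(\hat U\hat O)$ for all Pauli operators $\hat O$. The induced distribution $\pi_\mu$ on $\mathcal C_n$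 is $\pi_\mu(U)=\sum_{\hat U\text{ with tableau }U}\mu(\hat U)$. A distribution $\pi$ on $\mathcal C_n$ is Pauli mixing if $\Pr_{U\sim\pi}[Ux=y]=\frac1{4^n-1}$ for all nonzero $x,y\in\mathbb F_2^{2n}$. The cost of an element of $\mathfrak C_n$ (up to phase) or of $\mathcal C_n$ is the minimum number of CNOT gates in a circuit of Hadamard, Phase and CNOT gates that implements it; the average costs are $\sum_{\hat U}\mu(\hat U)\,\mathrm{cost}(\hat U)$ and $\sum_U\pi(U)\,\mathrm{cost}(U)$. (1) If $\mu$ is a Pauli-invariant probability distribution on $\mathfrak C_n$, then $\pi_\mu$ is a probability distribution, $\pi_\mu(U)=4^n\mu(\hat U)$ for every $\hat U$ with tableau $U$, $\mu$ is a unitary 2-design if and only if $\pi_\mu$ is Pauli mixing, and $\mu$ and $\pi_\mu$ have the same average cost. (2) For every probability distribution $\pi$ on $\mathcal C_n$, setting $\mu(\hat U)=4^{-n}\pi(U)$ for $\hat U$ with tableau $U$ defines a Pauli-invariant probability distribution on $\mathfrak C_n$ with $\pi_\mu=\pi$. (3) Let $\mathcal C_n^0\subseteq\mathcal C_n$ be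 the subgroup generated by the single-qubit Hadamard and Phase gates, $S_n\subseteq\mathcal C_n$ the qubit permutations, and $[U]=\{KW^{-1}UWL: K,L\in\mathcal C_n^0,\ W\in S_n\}$. Let $f:\mathcal C_n\to\mathcal C_n$ be any choice of class representatives, i.e. $f(U)\in[U]$, and $f(U)=f(V)$ if and only if $V\in[U]$; let $\mathcal R_n=f(\mathcal C_n)$ and $g(U,x,y)=\#\{U'\in[U]:U'x=y\}/|[U]|$. Consider the linear program in the variables $\eta(U)$, $U\in\mathcal R_n$: $$\text{minimize}\ \sum_{U\in\mathcal R_n}\eta(U)\,\mathrm{cost}(U)\quad\text{subject to}\quad \eta\ge0,\quad \sum_{U\in\mathcal R_n}\eta(U)=1,\quad \sum_{U\in\mathcal R_n}\eta(U)\,g(U,x,y)=\frac1{4^n-1}$$ where the last constraint is imposed for all $x=(0^n,z)$, $y=(0^n,w)$ with $z,w\in\mathbb F_2^n\setminus\{0\}$; it has $|\mathcal R_n|$ variables and $1+(2^n-1)^2$ equality constraints. For a distribution $\pi$ on $\mathcal C_n$ let $\eta_\pi(U)=\sum_{U'\in[U]}\pi(U')$, and for $\eta:\mathcal R_n\to\mathbb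 R$ let $\mu_\eta(\hat U)=4^{-n}\eta(f(U))/|[U]|$, where $U$ is the tableau of $\hat U$. Then: (a) a probability distribution $\pi$ on $\mathcal C_n$ that is constant on the classes $[U]$ satisfies $\pi(U)=\eta_\pi(f(U))/|[U]|$, and it is Pauli mixing if and only if $\eta_\pi$ is feasible; (b) for every 2-design $\mu$ on $\mathfrak C_n$, Pauli-invariant or not, $\eta_{\pi_\mu}$ is feasible and its objective value is the average cost of $\mu$; (c) for every feasible $\eta$, $\mu_\eta$ is a Pauli-invariant 2-design on $\mathfrak C_n$ with average cost equal to the objective value of $\eta$, and the reduced distribution of $U\mapsto\eta(f(U))/|[U]|$ is $\eta$; (d) if $\mu$ is a 2-design on $\mathfrak C_n$ of minimum average cost, then $\eta_{\pi_\mu}$ is an optimal solution of the linear program; for every $\eta:\mathcal R_n\to\mathbb R$, $\eta$ is an optimal solution if and only if $\mu_\eta$ is a 2-design on $\mathfrak C_n$ of minimum average cost; and an optimal solution exists. -/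

import Mathlib

open scoped Matrix Kronecker

noncomputable section

namespace CliffordDesign

/-! ## Operators on `n` qubits -/

/-- Labels of the computational basis of `n` qubits. -/
abbrev Basis (n : ℕ) : Type := Fin n → Fin 2

/-- Complex matrices of size `2^n × 2^n`. -/
abbrev Op (n : ℕ) : Type := Matrix (Basis n) (Basis n) ℂ

/-- The unitary group `U(2^n)`. -/
abbrev UGroup (n : ℕ) : Type := Matrix.unitaryGroup (Basis n) ℂ

/-- The tensor product `f 0 ⊗ ⋯ ⊗ f (n-1)` of single-qubit operators. -/
def tensor {n : ℕ} (f : Fin n → Matrix (Fin 2) (Fin 2) ℂ) : Op n :=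
  Matrix.of fun a b => ∏ j, f j (a j) (b j)

/-- Bit strings `v ∈ {0,1}^{2n}`; `v (inl j)` is `v_j` and `v (inr j)` is `v_{n+j}`. -/
abbrev BitVec2 (n : ℕ) : Type := Fin n ⊕ Fin n → ZMod 2

/-- The single-qubit Pauli operators: `00 ↦ I`, `10 ↦ X`, `01 ↦ Z`, `11 ↦ Y`. -/
def pauli1 (x z : ZMod 2) : Matrix (Fin 2) (Fin 2) ℂ :=
  if x = 0 then (if z = 0 then 1 else !![1, 0; 0, -1])
  else (if z = 0 then !![0, 1; 1, 0] else !![0, -Complex.I; Complex.I, 0])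

/-- The Pauli operator `O(v) = O(v_1 v_{n+1}) ⊗ ⋯ ⊗ O(v_n v_{2n})`. -/
def pauliOp {n : ℕ} (v : BitVec2 n) : Op n :=
  tensor fun j => pauli1 (v (Sum.inl j)) (v (Sum.inr j))

theorem tensor_mul {n : ℕ} (f g : Fin n → Matrix (Fin 2) (Fin 2) ℂ) :
    tensor f * tensor g = tensor (fun j => f j * g j) := by
  ext a b
  simp only [tensor, Matrix.mul_apply, Matrix.of_apply]
  rw [Finset.prod_univ_sum]
  simp only [Fintype.piFinset_univ, Finset.prod_mul_distrib]

theorem tensor_one {n : ℕ} : tensor (fun _ : Fin n => 1) = (1 : Op n) := by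
  ext a b
  simp only [tensor, Matrix.of_apply, Matrix.one_apply]
  by_cases h : a = b
  · simp [h]
  · obtain ⟨j, hj⟩ := Function.ne_iff.mp h
    rw [if_neg h]
    exact Finset.prod_eq_zero (Finset.mem_univ j) (by simp [hj])

theorem tensor_star {n : ℕ} (f : Fin n → Matrix (Fin 2) (Fin 2) ℂ) :
    star (tensor f) = tensor (fun j => star (f j)) := by
  ext a b
  simp [tensor, Matrix.star_apply]

theorem tensor_smul {n : ℕ} (c : Fin n → ℂ) (f : Fin n → Matrix (Fin 2) (Fin 2) ℂ) :
    tensor (fun j => c j • f j) = (∏ j, c j) • tensor f := by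
  ext a b
  simp [tensor, Finset.prod_mul_distrib]

theorem zmod2_cases (x : ZMod 2) : x = 0 ∨ x = 1 := by
  revert x; decide

theorem pauli1_00 : pauli1 0 0 = 1 := by simp [pauli1]

theorem pauli1_01 : pauli1 0 1 = !![1, 0; 0, -1] := by simp [pauli1]

theorem pauli1_10 : pauli1 1 0 = !![0, 1; 1, 0] := by simp [pauli1]

theorem pauli1_11 : pauli1 1 1 = !![0, -Complex.I; Complex.I, 0] := by simp [pauli1]

theorem pauli1_star (x z : ZMod 2) : star (pauli1 x z) = pauli1 x z := by
  rcases zmod2_cases x with rfl | rfl <;> rcases zmod2_cases z with rfl | rfl <;>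
    simp only [pauli1_00, pauli1_01, pauli1_10, pauli1_11] <;>
    ext i j <;> fin_cases i <;> fin_cases j <;> simp [Matrix.star_apply]

theorem pauli1_sq (x z : ZMod 2) : pauli1 x z * pauli1 x z = 1 := by
  rcases zmod2_cases x with rfl | rfl <;> rcases zmod2_cases z with rfl | rfl <;>
    simp only [pauli1_00, pauli1_01, pauli1_10, pauli1_11] <;>
    ext i j <;> fin_cases i <;> fin_cases j <;> simp [Matrix.mul_apply]

theorem pauli1_conj (x z x' z' : ZMod 2) :
    ∃ c : ℂ, (c = 1 ∨ c = -1) ∧ pauli1 x z * pauli1 x' z' * pauli1 x z = c • pauli1 x' z' := by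
  rcases zmod2_cases x with rfl | rfl <;> rcases zmod2_cases z with rfl | rfl <;>
    rcases zmod2_cases x' with rfl | rfl <;> rcases zmod2_cases z' with rfl | rfl <;>
    simp only [pauli1_00, pauli1_01, pauli1_10, pauli1_11] <;>
    first
    | (refine ⟨1, Or.inl rfl, ?_⟩
       ext i j; fin_cases i <;> fin_cases j <;> (simp; done))
    | (refine ⟨-1, Or.inr rfl, ?_⟩
       ext i j; fin_cases i <;> fin_cases j <;> (simp; done))

theorem prod_sign {ι : Type*} (s : Finset ι) (c : ι → ℂ) (h : ∀ j, c j = 1 ∨ c j = -1) :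
    (∏ j ∈ s, c j) = 1 ∨ (∏ j ∈ s, c j) = -1 := by
  classical
  induction s using Finset.induction_on with
  | empty => simp
  | insert a s ha ih =>
    rw [Finset.prod_insert ha]
    rcases h a with h1 | h1 <;> rcases ih with h2 | h2 <;> simp [h1, h2]

theorem pauliOp_star {n : ℕ} (v : BitVec2 n) : star (pauliOp v) = pauliOp v := by
  simp [pauliOp, tensor_star, pauli1_star]

theorem pauliOp_sq {n : ℕ} (v : BitVec2 n) : pauliOp v * pauliOp v = 1 := by
  simp [pauliOp, tensor_mul, pauli1_sq, tensor_one]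

theorem pauliOp_conj {n : ℕ} (w v : BitVec2 n) :
    pauliOp w * pauliOp v * star (pauliOp w) = pauliOp v ∨
      pauliOp w * pauliOp v * star (pauliOp w) = -pauliOp v := by
  choose c hc hc' using fun j => pauli1_conj (w (Sum.inl j)) (w (Sum.inr j))
    (v (Sum.inl j)) (v (Sum.inr j))
  rw [pauliOp_star]
  have : pauliOp w * pauliOp v * pauliOp w = (∏ j, c j) • pauliOp v := by
    simp only [pauliOp, tensor_mul, hc', tensor_smul]
  rw [this]
  rcases prod_sign Finset.univ c hc with h | h <;> simp [h]

theorem pauliOp_zero {n : ℕ} : pauliOp (0 : BitVec2 n) = 1 := by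
  simp [pauliOp, pauli1, tensor_one]

/-- The Pauli operator `O(w)` as a unitary matrix. -/
def pauliU {n : ℕ} (w : BitVec2 n) : UGroup n :=
  ⟨pauliOp w, Matrix.mem_unitaryGroup_iff.mpr (by rw [pauliOp_star, pauliOp_sq])⟩

/-! ## The binary symplectic group and the unitary Clifford group -/

/-- The group `Sp(2n, F_2)`. (Over `F_2` the matrix `J` of Mathlib is `Ω_n`.) -/
abbrev Sp (n : ℕ) : Type := Matrix.symplecticGroup (Fin n) (ZMod 2)

instance instFintypeSp (n : ℕ) : Fintype (Sp n) := Fintype.ofFinite _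

/-- `Implements V U`: the unitary `V` acts on Pauli operators by conjugation as the symplectic
matrix `U` up to signs, i.e. `V O(v) V† = ± O(U v)` for all `v`. -/
def Implements {n : ℕ} (V : UGroup n) (U : Sp n) : Prop :=
  ∀ v : BitVec2 n,
    (V : Op n) * pauliOp v * star (V : Op n) = pauliOp (U.1 *ᵥ v) ∨
    (V : Op n) * pauliOp v * star (V : Op n) = -pauliOp (U.1 *ᵥ v)

theorem pauli1_trace (x z x' z' : ZMod 2) (h : (pauli1 x z * pauli1 x' z').trace ≠ 0) :
    x = x' ∧ z = z' := by
  revert h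
  rcases zmod2_cases x with rfl | rfl <;> rcases zmod2_cases z with rfl | rfl <;>
    rcases zmod2_cases x' with rfl | rfl <;> rcases zmod2_cases z' with rfl | rfl <;>
    simp [pauli1_00, pauli1_01, pauli1_10, pauli1_11, Matrix.trace_fin_two]

theorem tensor_trace {n : ℕ} (f : Fin n → Matrix (Fin 2) (Fin 2) ℂ) :
    (tensor f).trace = ∏ j, (f j).trace := by
  simp only [Matrix.trace, Matrix.diag_apply, tensor, Matrix.of_apply]
  rw [Finset.prod_univ_sum]
  simp only [Fintype.piFinset_univ]

theorem pauliOp_inj {n : ℕ} {v w : BitVec2 n} (h : pauliOp v = pauliOp w ∨ pauliOp v = -pauliOp w) :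
    v = w := by
  have h1 : (pauliOp v * pauliOp w).trace ≠ 0 := by
    rcases h with h | h <;> simp [h, pauliOp_sq]
  rw [pauliOp, pauliOp, tensor_mul, tensor_trace, Finset.prod_ne_zero_iff] at h1
  ext j
  rcases j with j | j
  · exact (pauli1_trace _ _ _ _ (h1 j (Finset.mem_univ j))).1
  · exact (pauli1_trace _ _ _ _ (h1 j (Finset.mem_univ j))).2

/-- The symplectic matrix implemented by a unitary matrix is unique. -/
theorem Implements.unique {n : ℕ} {V : UGroup n} {U U' : Sp n} (h : Implements V U)
    (h' : Implements V U') : U = U' := by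
  apply Subtype.ext
  apply Matrix.mulVec_injective
  funext v
  apply pauliOp_inj
  rcases h v with k | k <;> rcases h' v with k' | k' <;> rw [k] at k'
  · exact Or.inl k'
  · exact Or.inr k'
  · exact Or.inr (by rw [← k', neg_neg])
  · exact Or.inl (neg_injective k')

theorem Implements.one {n : ℕ} : Implements (1 : UGroup n) (1 : Sp n) := fun v => by simp

theorem Implements.mul {n : ℕ} {V V' : UGroup n} {U U' : Sp n}
    (h : Implements V U) (h' : Implements V' U') : Implements (V * V') (U * U') := by
  intro v
  have e : ((V * V' : UGroup n) : Op n) * pauliOp v * star ((V * V' : UGroup n) : Op n)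
      = (V : Op n) * ((V' : Op n) * pauliOp v * star (V' : Op n)) * star (V : Op n) := by
    simp [mul_assoc]
  have e' : (U * U').1 *ᵥ v
      = U.1 *ᵥ (U'.1 *ᵥ v) := by
    simp [Matrix.mulVec_mulVec]
  rw [e, e']
  rcases h' v with h1 | h1 <;> rw [h1] <;>
    rcases h (U'.1 *ᵥ v) with h2 | h2 <;> simp [h2]

theorem Implements.inv {n : ℕ} {V : UGroup n} {U : Sp n}
    (h : Implements V U) : Implements V⁻¹ U⁻¹ := by
  intro v
  have hv : U.1 *ᵥ ((U⁻¹).1 *ᵥ v) = v := by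
    rw [Matrix.mulVec_mulVec, ← Submonoid.coe_mul, mul_inv_cancel]; simp
  have hinv : ((V⁻¹ : UGroup n) : Op n) = star (V : Op n) := rfl
  have h1 : star (V : Op n) * (V : Op n) = 1 := Matrix.UnitaryGroup.star_mul_self V
  have key := h ((U⁻¹).1 *ᵥ v)
  rw [hv] at key
  rw [hinv, star_star]
  set P := pauliOp ((U⁻¹).1 *ᵥ v)
  have e : star (V : Op n) * ((V : Op n) * P * star (V : Op n)) * (V : Op n) = P := by
    calc star (V : Op n) * ((V : Op n) * P * star (V : Op n)) * (V : Op n)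
        = (star (V : Op n) * (V : Op n)) * P * (star (V : Op n) * (V : Op n)) := by
          simp only [mul_assoc]
      _ = P := by simp [h1]
  rcases key with k | k <;> rw [k] at e
  · exact Or.inl e
  · right
    rw [← e]; simp

/-- The unitaries that map Pauli operators to Pauli operators (up to sign) under conjugation,
with overall phases still included. -/
def cliffordUnitary (n : ℕ) : Subgroup (UGroup n) where
  carrier := {V | ∃ U : Sp n, Implements V U}
  mul_mem' := by
    rintro _ _ ⟨U, hU⟩ ⟨U', hU'⟩
    exact ⟨_, hU.mul hU'⟩
  one_mem' := ⟨1, Implements.one⟩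
  inv_mem' := by
    rintro _ ⟨U, hU⟩
    exact ⟨_, hU.inv⟩

/-- The overall phase factors `c • 1`. -/
def phase (n : ℕ) : Subgroup (cliffordUnitary n) where
  carrier := {V | ∃ c : ℂ, ((V : UGroup n) : Op n) = c • 1}
  mul_mem' := by
    rintro V V' ⟨c, hc⟩ ⟨c', hc'⟩
    exact ⟨c * c', by simp [hc, hc', smul_smul, mul_comm]⟩
  one_mem' := ⟨1, by simp⟩
  inv_mem' := by
    rintro V ⟨c, hc⟩
    refine ⟨star c, ?_⟩
    have : (((V⁻¹ : cliffordUnitary n) : UGroup n) : Op n) = star ((V : UGroup n) : Op n) := rfl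
    rw [this, hc]; simp

instance phase_normal (n : ℕ) : (phase n).Normal where
  conj_mem := by
    rintro V ⟨c, hc⟩ W
    refine ⟨c, ?_⟩
    have h1 : ((W : UGroup n) : Op n) * star ((W : UGroup n) : Op n) = 1 :=
      Matrix.mem_unitaryGroup_iff.mp (W : UGroup n).2
    have : (((W * V * W⁻¹ : cliffordUnitary n) : UGroup n) : Op n)
      = ((W : UGroup n) : Op n) * ((V : UGroup n) : Op n) * star ((W : UGroup n) : Op n) := rfl
    rw [this, hc]; simp [h1]

/-- The unitary version of the `n`-qubit Clifford group, overall phases being ignored. -/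
abbrev Clifford (n : ℕ) : Type := cliffordUnitary n ⧸ phase n

/-- A unitary matrix that represents a given element of the Clifford group. -/
def Clifford.rep {n : ℕ} (q : Clifford n) : UGroup n := ((Quotient.out q : cliffordUnitary n) : UGroup n)

/-- The Pauli operator `O(w)` as an element of the Clifford group. -/
def pauli {n : ℕ} (w : BitVec2 n) : Clifford n :=
  QuotientGroup.mk ⟨pauliU w, 1, fun v => by simpa [pauliU] using pauliOp_conj w v⟩

/-- The symplectic matrix `U` of a Clifford group element: `V O(v) V† = ± O(U v)`. -/
def tableau {n : ℕ} (q : Clifford n) : Sp n := (Quotient.out q : cliffordUnitary n).2.choose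

theorem tableau_spec {n : ℕ} (q : Clifford n) : Implements q.rep (tableau q) :=
  (Quotient.out q : cliffordUnitary n).2.choose_spec

theorem pauli1_x (x a b : Fin 2) :
    pauli1 ((x : ℕ) : ZMod 2) 0 a b = if a = b + x then 1 else 0 := by
  revert x a b
  simp only [Fin.forall_fin_two]
  simp [pauli1_00, pauli1_10]

theorem pauli1_z (z : ZMod 2) (a b : Fin 2) :
    pauli1 0 z a b = if a = b then (if z = 1 ∧ a = 1 then -1 else 1) else 0 := by
  rcases zmod2_cases z with rfl | rfl <;> revert a b <;> simp only [Fin.forall_fin_two] <;>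
    simp [pauli1_00, pauli1_01]

theorem pauliOp_x {n : ℕ} (x a b : Basis n) :
    pauliOp (Sum.elim (fun j => ((x j : ℕ) : ZMod 2)) 0) a b = if a = b + x then 1 else 0 := by
  simp only [pauliOp, tensor, Matrix.of_apply, Sum.elim_inl, Sum.elim_inr, Pi.zero_apply, pauli1_x]
  by_cases h : a = b + x
  · simp [h]
  · obtain ⟨j, hj⟩ := Function.ne_iff.mp h
    rw [if_neg h]
    exact Finset.prod_eq_zero (Finset.mem_univ j) (by simpa using hj)

theorem pauliOp_z {n : ℕ} (j : Fin n) :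
    pauliOp (Sum.elim 0 (Pi.single j 1)) =
      (Matrix.diagonal fun a => if a j = 1 then -1 else 1 : Op n) := by
  ext a b
  simp only [pauliOp, tensor, Matrix.of_apply, Sum.elim_inl, Sum.elim_inr, Pi.zero_apply, pauli1_z,
    Matrix.diagonal_apply]
  by_cases h : a = b
  · subst h
    rw [Finset.prod_eq_single j]
    · simp
    · intro i _ hi
      simp [hi]
    · simp
  · obtain ⟨j, hj⟩ := Function.ne_iff.mp h
    rw [if_neg h]
    exact Finset.prod_eq_zero (Finset.mem_univ j) (by simp [hj])

/-- Schur's lemma for Pauli operators. -/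
theorem scalar_of_commute {n : ℕ} (W : Op n)
    (h : ∀ v : BitVec2 n, W * pauliOp v = pauliOp v * W) : ∃ c : ℂ, W = c • 1 := by
  refine ⟨W 0 0, ?_⟩
  ext a b
  by_cases hab : a = b
  · subst hab
    have key := congrFun (congrFun (h (Sum.elim (fun j => ((a j : ℕ) : ZMod 2)) 0)) a) 0
    have haa : ∀ c : Basis n, a = c + a ↔ c = 0 := fun c => by
      constructor
      · intro hc; exact (left_eq_add.mp (by rw [add_comm]; exact hc))
      · rintro rfl; simp
    simp only [Matrix.mul_apply, pauliOp_x, mul_ite, mul_one, mul_zero, zero_add, ite_mul, one_mul,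
      zero_mul, haa, Finset.sum_ite_eq', Finset.mem_univ, if_true] at key
    simp [key]
  · obtain ⟨j, hj⟩ := Function.ne_iff.mp hab
    have key := congrFun (congrFun (h (Sum.elim 0 (Pi.single j 1))) a) b
    rw [pauliOp_z, Matrix.mul_diagonal, Matrix.diagonal_mul] at key
    have : W a b = 0 := by
      have h2 : ∀ s : Fin 2, s = 0 ∨ s = 1 := by decide
      rcases h2 (a j) with ha | ha <;> rcases h2 (b j) with hb | hb <;>
        simp [ha, hb] at hj key
      · linear_combination (-1 / 2) * key
      · linear_combination (1 / 2) * key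
    simp [this, hab]

instance instFiniteClifford (n : ℕ) : Finite (Clifford n) := by
  let S : Set (Op n) := Set.range (fun v : BitVec2 n => pauliOp v) ∪
    Set.range (fun v : BitVec2 n => -pauliOp v)
  have hS : S.Finite := (Set.finite_range _).union (Set.finite_range _)
  have : Finite S := hS
  let F : Clifford n → BitVec2 n → S := fun q v =>
    ⟨(q.rep : Op n) * pauliOp v * star (q.rep : Op n), by
      rcases tableau_spec q v with h | h
      · exact Or.inl ⟨_, h.symm⟩
      · exact Or.inr ⟨_, h.symm⟩⟩
  refine Finite.of_injective F fun q q' hq => ?_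
  have h1 : star (q.rep : Op n) * (q.rep : Op n) = 1 := Matrix.UnitaryGroup.star_mul_self q.rep
  have h2 : star (q'.rep : Op n) * (q'.rep : Op n) = 1 := Matrix.UnitaryGroup.star_mul_self q'.rep
  obtain ⟨c, hc⟩ := scalar_of_commute (star (q.rep : Op n) * (q'.rep : Op n)) fun v => by
    have hv : (q.rep : Op n) * pauliOp v * star (q.rep : Op n)
        = (q'.rep : Op n) * pauliOp v * star (q'.rep : Op n) :=
      congrArg Subtype.val (congrFun hq v)
    calc star (q.rep : Op n) * (q'.rep : Op n) * pauliOp v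
        = star (q.rep : Op n) * ((q'.rep : Op n) * pauliOp v * star (q'.rep : Op n)) *
            (q'.rep : Op n) := by
          simp only [mul_assoc, h2, mul_one]
      _ = (star (q.rep : Op n) * (q.rep : Op n)) * pauliOp v *
            (star (q.rep : Op n) * (q'.rep : Op n)) := by
          rw [← hv]; simp only [mul_assoc]
      _ = pauliOp v * (star (q.rep : Op n) * (q'.rep : Op n)) := by rw [h1, one_mul]
  rw [← Quotient.out_eq q, ← Quotient.out_eq q']
  exact QuotientGroup.eq.mpr ⟨c, hc⟩

instance instFintypeClifford (n : ℕ) : Fintype (Clifford n) := Fintype.ofFinite _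

/-! ## Unitary 2-designs -/

instance instCompactUGroup (n : ℕ) : CompactSpace (UGroup n) := by
  let S : Set (Op n) := {M | ∀ i j, M i j ∈ Metric.closedBall (0 : ℂ) 1}
  have hS : IsCompact S := by
    have h : IsCompact {f : Basis n → Basis n → ℂ | ∀ i, f i ∈ {g : Basis n → ℂ |
        ∀ j, g j ∈ Metric.closedBall (0 : ℂ) 1}} :=
      isCompact_pi_infinite fun _ => isCompact_pi_infinite fun _ => isCompact_closedBall 0 1
    exact h
  have hU : IsClosed (Matrix.unitaryGroup (Basis n) ℂ : Set (Op n)) :=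
    isClosed_unitary (R := Op n)
  exact isCompact_iff_compactSpace.mp (hS.of_isClosed_subset hU fun U hU i j => by
    simpa using entry_norm_bound_of_unitary hU i j)

instance instMeasurableSpaceUGroup (n : ℕ) : MeasurableSpace (UGroup n) := borel _

instance instBorelSpaceUGroup (n : ℕ) : BorelSpace (UGroup n) := ⟨rfl⟩

/-- The Haar probability measure on `U(2^n)`. -/
def haar (n : ℕ) : MeasureTheory.Measure (UGroup n) := MeasureTheory.Measure.haarMeasure ⊤

/-- The operator `(V† A V) ⊗ (V† B V)`. -/
def twirlTerm {n : ℕ} (A B : Op n) (V : UGroup n) :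
    Matrix (Basis n × Basis n) (Basis n × Basis n) ℂ :=
  (star (V : Op n) * A * (V : Op n)) ⊗ₖ (star (V : Op n) * B * (V : Op n))

/-- Probability distributions on a finite set. -/
def IsProb {α : Type} [Fintype α] (p : α → ℝ) : Prop := (∀ a, 0 ≤ p a) ∧ ∑ a, p a = 1

/-- A finite family `D` of unitary matrices with weights `μ` is a unitary 2-design if its second
moment operator agrees, for all complex matrices `A` and `B`, with the Haar average (the integral
of a matrix-valued function is taken entrywise). -/
def IsUnitary2Design {n : ℕ} {ι : Type} [Fintype ι] (D : ι → UGroup n) (μ : ι → ℝ) : Prop :=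
  ∀ A B : Op n, ∑ i, (μ i : ℂ) • twirlTerm A B (D i) =
    Matrix.of fun a b => ∫ V, twirlTerm A B V a b ∂(haar n)

/-- The second moment operator does not depend on how overall phases are chosen. -/
theorem twirlTerm_rep {n : ℕ} (A B : Op n) (V : cliffordUnitary n) :
    twirlTerm A B (Clifford.rep (QuotientGroup.mk V)) = twirlTerm A B (V : UGroup n) := by
  obtain ⟨P, hP⟩ := QuotientGroup.mk_out_eq_mul (phase n) V
  obtain ⟨c, hc⟩ := P.2
  have hPu : star (((P : cliffordUnitary n) : UGroup n) : Op n) *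
      (((P : cliffordUnitary n) : UGroup n) : Op n) = 1 := Matrix.UnitaryGroup.star_mul_self _
  have hcc : star c * c = 1 := by
    rw [hc] at hPu
    have := congrFun (congrFun hPu 0) 0
    simpa [mul_comm] using this
  have hr : ((Clifford.rep (QuotientGroup.mk V) : UGroup n) : Op n)
      = c • ((V : UGroup n) : Op n) := by
    have : ((Clifford.rep (QuotientGroup.mk V) : UGroup n) : Op n)
      = ((V : UGroup n) : Op n) * (((P : cliffordUnitary n) : UGroup n) : Op n) := by
      unfold Clifford.rep
      exact congrArg (fun W : cliffordUnitary n => ((W : UGroup n) : Op n)) hP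
    rw [this, hc]; simp
  have key : ∀ M : Op n, star ((Clifford.rep (QuotientGroup.mk V) : UGroup n) : Op n) * M *
      ((Clifford.rep (QuotientGroup.mk V) : UGroup n) : Op n)
      = star ((V : UGroup n) : Op n) * M * ((V : UGroup n) : Op n) := by
    intro M
    rw [hr]
    simp [smul_smul, mul_comm c, show (starRingEnd ℂ) c * c = 1 from hcc]
  simp only [twirlTerm, key]

/-- A probability distribution `μ` on the Clifford group that is a unitary 2-design. -/
def IsClifford2Design {n : ℕ} (μ : Clifford n → ℝ) : Prop :=
  IsProb μ ∧ IsUnitary2Design Clifford.rep μ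

/-- `μ(V) = μ(V O)` for all Pauli operators `O`. -/
def PauliInvariant {n : ℕ} (μ : Clifford n → ℝ) : Prop :=
  ∀ (q : Clifford n) (w : BitVec2 n), μ q = μ (q * pauli w)

open Classical in
/-- The distribution on `Sp(2n, F_2)` induced by `μ`, i.e. the law of the symplectic matrix of a
random Clifford group element. -/
def induced {n : ℕ} (μ : Clifford n → ℝ) : Sp n → ℝ :=
  fun U => ∑ q with tableau q = U, μ q

/-- The distribution `μ(U × P) = π(U) / 4^n` on the Clifford group. -/
def pauliLift {n : ℕ} (π : Sp n → ℝ) : Clifford n → ℝ := fun q => π (tableau q) / 4 ^ n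

open Classical in
/-- `Pr_{U ∼ π}[U x = y] = 1 / (4^n - 1)` for all nonzero `x` and `y`. -/
def PauliMixing {n : ℕ} (π : Sp n → ℝ) : Prop :=
  ∀ x y : BitVec2 n, x ≠ 0 → y ≠ 0 → ∑ U : Sp n with U.1 *ᵥ x = y, π U = 1 / (4 ^ n - 1)

/-! ## Circuits and cost -/

/-- Hadamard, Phase and CNOT gates (`cnot c t` has control `c` and target `t`). -/
inductive Gate (n : ℕ) : Type
  | h (k : Fin n) : Gate n
  | p (k : Fin n) : Gate n
  | cnot (c t : Fin n) (hct : c ≠ t) : Gate n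

/-- `1` for CNOT gates, `0` for single-qubit gates. -/
def Gate.cost {n : ℕ} : Gate n → ℕ
  | .h _ => 0
  | .p _ => 0
  | .cnot _ _ _ => 1

/-- The number of CNOT gates in a circuit. -/
def cnotCount {n : ℕ} (c : List (Gate n)) : ℕ := (c.map Gate.cost).sum

/-- The single-qubit operator `g` acting on qubit `k`. -/
def onQubit {n : ℕ} (k : Fin n) (g : Matrix (Fin 2) (Fin 2) ℂ) : Op n :=
  tensor fun j => if j = k then g else 1

/-- The `2^n × 2^n` matrix of a gate. -/
def Gate.op {n : ℕ} : Gate n → Op n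
  | .h k => onQubit k ((1 / Real.sqrt 2 : ℂ) • !![1, 1; 1, -1])
  | .p k => onQubit k !![1, 0; 0, Complex.I]
  | .cnot c t _ => Matrix.of fun a b => if a = Function.update b t (b t + b c) then 1 else 0

/-- The tableau of a gate: `H` on qubit `k` is the identity matrix with columns `k` and `n+k`
swapped, `P` adds column `k` of the identity matrix to column `n+k`, and CNOT adds column `c` to
column `t` and column `n+t` to column `n+c`. -/
def Gate.tab {n : ℕ} : Gate n → Matrix (Fin n ⊕ Fin n) (Fin n ⊕ Fin n) (ZMod 2)
  | .h k => (1 : Matrix _ _ (ZMod 2)).submatrix id (Equiv.swap (Sum.inl k) (Sum.inr k))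
  | .p k => 1 + Matrix.single (Sum.inl k) (Sum.inr k) 1
  | .cnot c t _ =>
      1 + Matrix.single (Sum.inl c) (Sum.inl t) 1 + Matrix.single (Sum.inr t) (Sum.inr c) 1

/-- The minimum number of CNOT gates in a circuit over Hadamard, Phase and CNOT gates that
implements a given Clifford group element up to an overall phase. -/
def cost {n : ℕ} (q : Clifford n) : ℕ :=
  sInf {m | ∃ (c : List (Gate n)) (V : cliffordUnitary n), (QuotientGroup.mk V : Clifford n) = q ∧
    ((V : UGroup n) : Op n) = (c.map Gate.op).prod ∧ cnotCount c = m}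

/-- The minimum number of CNOT gates in a circuit that implements a symplectic matrix. -/
def costSp {n : ℕ} (U : Sp n) : ℕ :=
  sInf {m | ∃ c : List (Gate n), U.1 = (c.map Gate.tab).prod ∧ cnotCount c = m}

/-- The average cost of a distribution on the Clifford group. -/
def avgCost {n : ℕ} (μ : Clifford n → ℝ) : ℝ := ∑ q, μ q * cost q

/-- The average cost of a distribution on `Sp(2n, F_2)`. -/
def avgCostSp {n : ℕ} (π : Sp n → ℝ) : ℝ := ∑ U, π U * costSp U

/-- A Clifford 2-design of minimum average cost. -/
def IsOptimalDesign {n : ℕ} (μ : Clifford n → ℝ) : Prop :=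
  IsClifford2Design μ ∧ ∀ ν : Clifford n → ℝ, IsClifford2Design ν → avgCost μ ≤ avgCost ν

/-! ## Equivalence classes and reduced elements -/

/-- The local subgroup, generated by the single-qubit Clifford gates. -/
def localGroup (n : ℕ) : Subgroup (Sp n) :=
  Subgroup.closure {U | ∃ k : Fin n, U.1 = (Gate.h k).tab ∨ U.1 = (Gate.p k).tab}

/-- The qubit permutations in `Sp(2n, F_2)`. -/
def qubitPerms (n : ℕ) : Set (Sp n) :=
  {W | ∃ σ : Equiv.Perm (Fin n), W.1 = Equiv.Perm.permMatrix (ZMod 2) (Equiv.Perm.sumCongr σ σ)}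

/-- The class `[U] = {K W⁻¹ U W L : K, L local, W a qubit permutation}`. -/
def cls {n : ℕ} (U : Sp n) : Set (Sp n) :=
  {V | ∃ K ∈ localGroup n, ∃ L ∈ localGroup n, ∃ W ∈ qubitPerms n, V = K * W⁻¹ * U * W * L}

/-- `f` maps each symplectic matrix to a canonical representative of its class. -/
def IsReduction {n : ℕ} (f : Sp n → Sp n) : Prop :=
  (∀ U, f U ∈ cls U) ∧ ∀ U V, f U = f V ↔ V ∈ cls U

/-- The set of reduced elements. -/
abbrev Reduced {n : ℕ} (f : Sp n → Sp n) : Type := Set.range f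

instance instFintypeReduced {n : ℕ} (f : Sp n → Sp n) : Fintype (Reduced f) := Fintype.ofFinite _

open Classical in
/-- The reduced distribution `η(U) = ∑_{U' ∈ [U]} π(U')`. -/
def reducedDist {n : ℕ} (f : Sp n → Sp n) (π : Sp n → ℝ) : Reduced f → ℝ :=
  fun r => ∑ U with U ∈ cls r.1, π U

/-- The class-invariant distribution `π(U) = η(f U) / |[U]|` given by a reduced distribution. -/
def symLift {n : ℕ} (f : Sp n → Sp n) (η : Reduced f → ℝ) : Sp n → ℝ :=
  fun U => η ⟨f U, U, rfl⟩ / (cls U).ncard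

/-- `g(U,x,y)`: the probability that a uniformly random element of `[U]` maps `x` to `y`. -/
def transProb {n : ℕ} (U : Sp n) (x y : BitVec2 n) : ℝ :=
  ({U' | U' ∈ cls U ∧ U'.1 *ᵥ x = y} : Set (Sp n)).ncard / (cls U).ncard

/-! ## The linear program -/

/-- A linear program in standard form: minimize `c ⬝ η` subject to `A η = b` and `η ≥ 0`. -/
structure LinearProgram (ι κ : Type) where
  c : ι → ℝ
  A : Matrix κ ι ℝ
  b : κ → ℝ

namespace LinearProgram

variable {ι κ : Type} [Fintype ι]

/-- The objective function. -/
def value (P : LinearProgram ι κ) (η : ι → ℝ) : ℝ := P.c ⬝ᵥ η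

/-- The feasible points. -/
def Feasible (P : LinearProgram ι κ) (η : ι → ℝ) : Prop := (∀ i, 0 ≤ η i) ∧ P.A *ᵥ η = P.b

/-- The optimal solutions. -/
def IsOptimal (P : LinearProgram ι κ) (η : ι → ℝ) : Prop :=
  P.Feasible η ∧ ∀ ξ, P.Feasible ξ → P.value η ≤ P.value ξ

end LinearProgram

/-- Nonzero bit strings of length `n`. -/
abbrev NZ (n : ℕ) : Type := {z : Fin n → ZMod 2 // z ≠ 0}

/-- Minimize `∑ η(U) cost(U)` over `η : Reduced f → ℝ`, `η ≥ 0`, subject to `∑ η(U) = 1` and to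
`∑ η(U) g(U,x,y) = 1 / (4^n - 1)` for `x = 0^n z` and `y = 0^n w` with nonzero `z` and `w`. -/
def designLP {n : ℕ} (f : Sp n → Sp n) : LinearProgram (Reduced f) (Option (NZ n × NZ n)) where
  c r := costSp r.1
  A
    | none, _ => 1
    | some (z, w), r => transProb r.1 (Sum.elim 0 z.1) (Sum.elim 0 w.1)
  b
    | none => 1
    | some _ => 1 / (4 ^ n - 1)

end CliffordDesign

end

open CliffordDesign

namespace CliffordDesign

/-! ## Commutation signs and products of Pauli operators -/

/-! Everything unitary is reduced to the action of Sp(2n, F_2) on nonzero vectors; the linear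
program then comes from averaging over classes.

Second moments. The design identity is bilinear in A and B and Pauli operators span, so it suffices
to test A = O(a), B = O(b) (`isUnitary2Design_iff`). On the Haar side, left invariance under Pauli
operators kills the terms a ≠ b. Left invariance under Clifford unitaries, together with
transitivity of Sp(2n, F_2) on nonzero vectors, makes the terms a = b ≠ 0 all equal. Their total is
known because the sum of O(v) ⊗ O(v) is a multiple of the swap operator and commutes with V ⊗ V, so
each equals (4^n - 1)⁻¹ times the sum of O(y) ⊗ O(y) over y ≠ 0 (`haarTwirl_pauliOp_self`). On the
Clifford side an element with tableau U contributes O(U⁻¹a) ⊗ O(U⁻¹a), the signs cancelling.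
Comparing coefficients gives Pauli mixing; conversely Pauli invariance supplies the vanishing for a
≠ b.

Tableaux and costs. The tableau map is a surjective homomorphism whose kernel is the 4^n Pauli
operators. It is onto because transvections generate Sp(2n, F_2) (`mem_of_transvection_mem`) and the
transvection along c is implemented by (1 + i O(c))/√2. So Pauli-invariant distributions and
distributions on Sp(2n, F_2) determine each other. Costs agree (`cost_eq_costSp`) since Pauli
operators need no CNOT. `Gate.tab` is the transpose of the action on Pauli operators; `Gate.dual`
translates between the two without changing the CNOT count.

The program. Cost is constant on classes. Pauli mixing survives U ↦ A U C, which only replaces (x,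
y) by (C x, A⁻¹ y), so averaging a mixing distribution over its classes keeps it mixing
(`IsReduction.sum_reducedDist_mul_transProb`). Conversely local gates make the first half of any
vector vanish, so for class-invariant distributions the listed constraints imply all others
(`pauliMixing_of_cls_invariant`). Hence designs map to feasible points and feasible points to
designs with costs preserved, and optimality transfers. An optimum exists by compactness, the
uniform distribution providing a feasible point. -/

/-- The symplectic form on bit strings. -/
def symp {n : ℕ} (v w : BitVec2 n) : ZMod 2 :=
  ∑ j, (v (Sum.inl j) * w (Sum.inr j) + v (Sum.inr j) * w (Sum.inl j))

theorem symp_add_left {n : ℕ} (u v w : BitVec2 n) : symp (u + v) w = symp u w + symp v w := by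
  simp only [symp, Pi.add_apply, ← Finset.sum_add_distrib]
  exact Finset.sum_congr rfl fun j _ => by ring

theorem symp_comm {n : ℕ} (v w : BitVec2 n) : symp v w = symp w v :=
  Finset.sum_congr rfl fun j _ => by ring

theorem symp_add_right {n : ℕ} (u v w : BitVec2 n) : symp u (v + w) = symp u v + symp u w := by
  rw [symp_comm, symp_add_left, symp_comm v, symp_comm w]

theorem symp_self {n : ℕ} (v : BitVec2 n) : symp v v = 0 :=
  Finset.sum_eq_zero fun j _ => by
    rw [mul_comm]
    exact CharTwo.add_self_eq_zero _

theorem symp_single_inl {n : ℕ} (v : BitVec2 n) (k : Fin n) :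
    symp v (Pi.single (Sum.inl k) 1) = v (Sum.inr k) := by
  simp [symp, Pi.single_apply]

theorem symp_single_inr {n : ℕ} (v : BitVec2 n) (k : Fin n) :
    symp v (Pi.single (Sum.inr k) 1) = v (Sum.inl k) := by
  simp [symp, Pi.single_apply]

/-- `v` vanishes outside the qubits in `S`. -/
def SupportedOn {n : ℕ} (S : Finset (Fin n)) (v : BitVec2 n) : Prop :=
  ∀ j ∉ S, v (Sum.inl j) = 0 ∧ v (Sum.inr j) = 0

theorem SupportedOn.add {n : ℕ} {S : Finset (Fin n)} {v w : BitVec2 n} (hv : SupportedOn S v)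
    (hw : SupportedOn S w) : SupportedOn S (v + w) := fun j hj => by
  simp [hv j hj, hw j hj]

theorem supportedOn_univ {n : ℕ} (v : BitVec2 n) : SupportedOn Finset.univ v :=
  fun j hj => absurd (Finset.mem_univ j) hj

theorem supportedOn_inl {n : ℕ} {S : Finset (Fin n)} {k : Fin n} (hk : k ∈ S) :
    SupportedOn S (Pi.single (Sum.inl k) 1) := fun j hj => by
  have : j ≠ k := fun h => hj (h ▸ hk)
  simp [this]

theorem supportedOn_inr {n : ℕ} {S : Finset (Fin n)} {k : Fin n} (hk : k ∈ S) :
    SupportedOn S (Pi.single (Sum.inr k) 1) := fun j hj => by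
  have : j ≠ k := fun h => hj (h ▸ hk)
  simp [this]

theorem SupportedOn.exists_symp_eq_one {n : ℕ} {S : Finset (Fin n)} {v : BitVec2 n}
    (hS : SupportedOn S v) (h : v ≠ 0) : ∃ w, SupportedOn S w ∧ symp v w = 1 := by
  obtain ⟨i, hi⟩ := Function.ne_iff.mp h
  have h1 : v i = 1 := (zmod2_cases _).resolve_left hi
  rcases i with k | k
  · have hk : k ∈ S := by
      by_contra hk
      exact hi (hS k hk).1
    exact ⟨_, supportedOn_inr hk, by rw [symp_single_inr, h1]⟩
  · have hk : k ∈ S := by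
      by_contra hk
      exact hi (hS k hk).2
    exact ⟨_, supportedOn_inl hk, by rw [symp_single_inl, h1]⟩

/-- Two nonzero vectors have a common non-orthogonal vector. -/
theorem SupportedOn.exists_symp_eq_one_both {n : ℕ} {S : Finset (Fin n)} {v w : BitVec2 n}
    (hSv : SupportedOn S v) (hSw : SupportedOn S w) (hv : v ≠ 0) (hw : w ≠ 0) :
    ∃ c, SupportedOn S c ∧ symp v c = 1 ∧ symp w c = 1 := by
  obtain ⟨c, hSc, hc⟩ := hSv.exists_symp_eq_one hv
  obtain ⟨d, hSd, hd⟩ := hSw.exists_symp_eq_one hw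
  rcases zmod2_cases (symp w c) with h | h
  · rcases zmod2_cases (symp v d) with h' | h'
    -- Here `c` pairs only with `v` and `d` only with `w`, so their sum pairs with both.
    · exact ⟨c + d, hSc.add hSd, by simp [symp_add_right, hc, h'],
        by simp [symp_add_right, hd, h]⟩
    · exact ⟨d, hSd, h', hd⟩
  · exact ⟨c, hSc, hc, h⟩

theorem exists_symp_eq_one {n : ℕ} {v : BitVec2 n} (h : v ≠ 0) : ∃ w, symp v w = 1 :=
  let ⟨w, _, hw⟩ := (supportedOn_univ v).exists_symp_eq_one h
  ⟨w, hw⟩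

/-- The sign `(-1)^a`. -/
def sgn (a : ZMod 2) : ℂ := if a = 0 then 1 else -1

theorem sgn_zero : sgn 0 = 1 := by simp [sgn]

theorem sgn_one : sgn 1 = -1 := by simp [sgn]

theorem sgn_add (a b : ZMod 2) : sgn (a + b) = sgn a * sgn b := by
  rcases zmod2_cases a with rfl | rfl <;> rcases zmod2_cases b with rfl | rfl <;>
    simp [sgn_zero, sgn_one, CharTwo.add_self_eq_zero]

theorem sgn_mul_self (a : ZMod 2) : sgn a * sgn a = 1 := by
  rw [← sgn_add, CharTwo.add_self_eq_zero, sgn_zero]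

theorem sgn_sum {ι : Type*} (s : Finset ι) (f : ι → ZMod 2) :
    sgn (∑ j ∈ s, f j) = ∏ j ∈ s, sgn (f j) := by
  classical
  induction s using Finset.induction_on with
  | empty => simp [sgn_zero]
  | insert a s ha ih => rw [Finset.sum_insert ha, Finset.prod_insert ha, sgn_add, ih]

theorem pauli1_comm (x z x' z' : ZMod 2) :
    pauli1 x z * pauli1 x' z' = sgn (x * z' + z * x') • (pauli1 x' z' * pauli1 x z) := by
  rcases zmod2_cases x with rfl | rfl <;> rcases zmod2_cases z with rfl | rfl <;>
    rcases zmod2_cases x' with rfl | rfl <;> rcases zmod2_cases z' with rfl | rfl <;>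
    simp [pauli1_00, pauli1_01, pauli1_10, pauli1_11, sgn_zero, sgn_one,
      CharTwo.add_self_eq_zero]

theorem pauliOp_comm {n : ℕ} (v w : BitVec2 n) :
    pauliOp v * pauliOp w = sgn (symp v w) • (pauliOp w * pauliOp v) := by
  simp only [pauliOp, tensor_mul, symp, sgn_sum, ← tensor_smul]
  exact congrArg tensor (funext fun j => pauli1_comm _ _ _ _)

theorem pauliOp_conj_eq {n : ℕ} (w v : BitVec2 n) :
    pauliOp w * pauliOp v * pauliOp w = sgn (symp w v) • pauliOp v := by
  rw [pauliOp_comm, Matrix.smul_mul, mul_assoc, pauliOp_sq, mul_one]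

/-- The exact phase is not tracked: a fourth root of unity has modulus 1, and self-adjointness fixes
it up to sign in `pauliOp_mul_of_anticomm`. -/
theorem pauli1_mul (x z x' z' : ZMod 2) :
    ∃ c : ℂ, c ^ 4 = 1 ∧ pauli1 x z * pauli1 x' z' = c • pauli1 (x + x') (z + z') := by
  rcases zmod2_cases x with rfl | rfl <;> rcases zmod2_cases z with rfl | rfl <;>
    rcases zmod2_cases x' with rfl | rfl <;> rcases zmod2_cases z' with rfl | rfl <;>
    simp only [pauli1_00, pauli1_01, pauli1_10, pauli1_11, CharTwo.add_self_eq_zero, zero_add,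
      add_zero] <;>
    first
    | (refine ⟨1, by norm_num, ?_⟩
       simp [Matrix.one_fin_two]; done)
    | (refine ⟨Complex.I, Complex.I_pow_four, ?_⟩
       simp; done)
    | (refine ⟨-Complex.I, by rw [Even.neg_pow (by decide)]; exact Complex.I_pow_four, ?_⟩
       simp; done)

theorem pauliOp_mul {n : ℕ} (v w : BitVec2 n) :
    ∃ c : ℂ, c ^ 4 = 1 ∧ pauliOp v * pauliOp w = c • pauliOp (v + w) := by
  choose c hc hc' using fun j => pauli1_mul (v (Sum.inl j)) (v (Sum.inr j))
    (w (Sum.inl j)) (w (Sum.inr j))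
  refine ⟨∏ j, c j, ?_, ?_⟩
  · rw [← Finset.prod_pow]
    exact Finset.prod_eq_one fun j _ => hc j
  · simp only [pauliOp, tensor_mul, hc', tensor_smul, Pi.add_apply]

theorem pauliOp_ne_zero {n : ℕ} (v : BitVec2 n) : pauliOp v ≠ 0 := fun h => by
  simpa [h] using pauliOp_sq v

/-- The product of two anticommuting self-adjoint operators is anti-self-adjoint, so its phase
relative to `pauliOp (v + w)` is purely imaginary of modulus 1, that is, ±i. -/
theorem pauliOp_mul_of_anticomm {n : ℕ} {v w : BitVec2 n} (h : symp v w = 1) :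
    Complex.I • (pauliOp v * pauliOp w) = pauliOp (v + w) ∨
      Complex.I • (pauliOp v * pauliOp w) = -pauliOp (v + w) := by
  obtain ⟨c, hc, e⟩ := pauliOp_mul v w
  have hs : star (pauliOp v * pauliOp w) = -(pauliOp v * pauliOp w) := by
    rw [star_mul, pauliOp_star, pauliOp_star, pauliOp_comm, symp_comm, h, sgn_one, neg_one_smul]
  rw [e, star_smul, pauliOp_star, ← neg_smul] at hs
  have hs' : star c = -c := smul_left_injective ℂ (pauliOp_ne_zero (v + w)) hs
  have hre : c.re = 0 := by
    have := congrArg Complex.re hs'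
    simp at this
    linarith
  have hn : ‖c‖ = 1 := Complex.norm_eq_one_of_pow_eq_one hc (by norm_num)
  have hcI : c = c.im * Complex.I := by
    apply Complex.ext <;> simp [hre]
  have him : |c.im| = 1 := by
    rw [hcI] at hn
    simpa using hn
  rw [e, smul_smul, hcI]
  have : Complex.I * (c.im * Complex.I) = -(c.im : ℂ) := by
    linear_combination (c.im : ℂ) * Complex.I_mul_I
  rw [this]
  rcases (abs_eq zero_le_one).mp him with k | k <;> simp [k]

/-! ## Pauli operators as an orthogonal basis -/

/-- Entrywise form of I⊗I + X⊗X + Y⊗Y + Z⊗Z = 2·SWAP. Its tensor power yields both the Pauli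
expansion and the swap identity. -/
theorem pauli1_complete (a b a' b' : Fin 2) :
    ∑ p : ZMod 2 × ZMod 2, pauli1 p.1 p.2 a b * pauli1 p.1 p.2 a' b' =
      if a = b' ∧ b = a' then 2 else 0 := by
  have h : (Finset.univ : Finset (ZMod 2)) = {0, 1} := by decide
  rw [Fintype.sum_prod_type, h]
  simp only [Finset.sum_pair (zero_ne_one (α := ZMod 2)), pauli1_00, pauli1_01, pauli1_10,
    pauli1_11]
  revert a b a' b'
  simp only [Fin.forall_fin_two]
  simp
  norm_num

theorem pauliOp_complete {n : ℕ} (a b a' b' : Basis n) :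
    ∑ v : BitVec2 n, pauliOp v a b * pauliOp v a' b' = if a = b' ∧ b = a' then 2 ^ n else 0 := by
  have e : ∑ v : BitVec2 n, pauliOp v a b * pauliOp v a' b' =
      ∑ f : Fin n → ZMod 2 × ZMod 2,
        ∏ j, (pauli1 (f j).1 (f j).2 (a j) (b j) * pauli1 (f j).1 (f j).2 (a' j) (b' j)) := by
    refine Fintype.sum_equiv ((Equiv.sumArrowEquivProdArrow _ _ _).trans
      (Equiv.arrowProdEquivProdArrow _ _ _).symm) _ _ fun v => ?_
    simp only [pauliOp, tensor, Matrix.of_apply, ← Finset.prod_mul_distrib]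
    rfl
  rw [e]
  have e2 := Finset.prod_univ_sum (fun _ : Fin n => (Finset.univ : Finset (ZMod 2 × ZMod 2)))
    (fun j p => pauli1 p.1 p.2 (a j) (b j) * pauli1 p.1 p.2 (a' j) (b' j))
  rw [Fintype.piFinset_univ] at e2
  rw [← e2]
  simp only [pauli1_complete]
  by_cases h : a = b' ∧ b = a'
  · rw [if_pos h]
    obtain ⟨rfl, rfl⟩ := h
    simp
  · rw [if_neg h]
    obtain ⟨j, hj⟩ : ∃ j, ¬(a j = b' j ∧ b j = a' j) := by
      by_contra! hc
      exact h ⟨funext fun j => (hc j).1, funext fun j => (hc j).2⟩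
    exact Finset.prod_eq_zero (Finset.mem_univ j) (if_neg hj)

/-- Every operator is a combination of Pauli operators. -/
theorem pauliOp_expand {n : ℕ} (M : Op n) :
    M = ∑ v : BitVec2 n, ((2 ^ n : ℂ)⁻¹ * (pauliOp v * M).trace) • pauliOp v := by
  ext a b
  have h2 : (2 ^ n : ℂ) ≠ 0 := pow_ne_zero n two_ne_zero
  simp only [Matrix.sum_apply, Matrix.smul_apply, smul_eq_mul, Matrix.trace, Matrix.diag_apply,
    Matrix.mul_apply, Finset.mul_sum, Finset.sum_mul]
  rw [Finset.sum_comm]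
  have : ∀ i, ∑ v : BitVec2 n, ∑ j, (2 ^ n : ℂ)⁻¹ * (pauliOp v i j * M j i) * pauliOp v a b =
      ∑ j, (if a = j ∧ b = i then M j i else 0) := by
    intro i
    rw [Finset.sum_comm]
    refine Finset.sum_congr rfl fun j _ => ?_
    have := pauliOp_complete a b i j
    calc _ = (2 ^ n : ℂ)⁻¹ * M j i * ∑ v : BitVec2 n, pauliOp v a b * pauliOp v i j := by
          rw [Finset.mul_sum]
          exact Finset.sum_congr rfl fun v _ => by ring
      _ = _ := by
          rw [this]
          split_ifs <;> simp [h2, mul_comm]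
  simp [this, ite_and]

theorem pauliOp_trace_mul {n : ℕ} (v w : BitVec2 n) :
    (pauliOp v * pauliOp w).trace = if v = w then 2 ^ n else 0 := by
  split_ifs with h
  · subst h
    simp [pauliOp_sq, Matrix.trace_one]
  · by_contra hne
    rw [pauliOp, pauliOp, tensor_mul, tensor_trace] at hne
    rw [← ne_eq, Finset.prod_ne_zero_iff] at hne
    apply h
    ext (j | j)
    · exact (pauli1_trace _ _ _ _ (hne j (Finset.mem_univ j))).1
    · exact (pauli1_trace _ _ _ _ (hne j (Finset.mem_univ j))).2

theorem exists_trace_ne_zero {n : ℕ} {M : Op n} (h : M ≠ 0) :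
    ∃ v : BitVec2 n, (pauliOp v * M).trace ≠ 0 := by
  by_contra! hv
  exact h (by rw [pauliOp_expand M]; simp [hv])

/-- `∑ O(v) ⊗ O(v)` is a multiple of the swap operator, so it commutes with `V ⊗ V`. -/
theorem sum_pauliOp_kronecker_comm {n : ℕ} (M : Op n) :
    (∑ v : BitVec2 n, pauliOp v ⊗ₖ pauliOp v) * (M ⊗ₖ M) =
      (M ⊗ₖ M) * ∑ v : BitVec2 n, pauliOp v ⊗ₖ pauliOp v := by
  have hS : (∑ v : BitVec2 n, pauliOp v ⊗ₖ pauliOp v) =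
      Matrix.of fun p q : Basis n × Basis n => if p.1 = q.2 ∧ q.1 = p.2 then (2 ^ n : ℂ) else 0 := by
    ext p q
    simp only [Matrix.sum_apply, Matrix.kroneckerMap_apply, Matrix.of_apply, pauliOp_complete]
  rw [hS]
  ext ⟨a, b⟩ ⟨c, d⟩
  simp only [Matrix.mul_apply, Matrix.of_apply, Matrix.kroneckerMap_apply, Fintype.sum_prod_type]
  simp only [ite_and, ite_mul, mul_ite, zero_mul, mul_zero, Finset.sum_ite_eq, Finset.sum_ite_eq',
    Finset.mem_univ, if_true]
  simp
  ring

/-! ## Symplectic transvections -/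

theorem J_mulVec_dotProduct {n : ℕ} (v w : BitVec2 n) :
    v ⬝ᵥ (Matrix.J (Fin n) (ZMod 2) *ᵥ w) = symp v w := by
  have : Matrix.J (Fin n) (ZMod 2) *ᵥ w = fun i => w i.swap := by
    ext (j | j) <;> simp [Matrix.J, Matrix.fromBlocks_mulVec, Matrix.neg_mulVec, ZMod.neg_eq_self_mod_two]
  simp [this, dotProduct, symp, Finset.sum_add_distrib]

theorem symp_mulVec {n : ℕ} (A : Matrix (Fin n ⊕ Fin n) (Fin n ⊕ Fin n) (ZMod 2))
    (v w : BitVec2 n) :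
    symp (A *ᵥ v) (A *ᵥ w) = v ⬝ᵥ ((Aᵀ * Matrix.J (Fin n) (ZMod 2) * A) *ᵥ w) := by
  rw [← J_mulVec_dotProduct, ← Matrix.mulVec_mulVec, ← Matrix.mulVec_mulVec, Matrix.dotProduct_mulVec v,
    Matrix.vecMul_transpose]

theorem mem_symplecticGroup_iff_symp {n : ℕ}
    {A : Matrix (Fin n ⊕ Fin n) (Fin n ⊕ Fin n) (ZMod 2)} :
    A ∈ Matrix.symplecticGroup (Fin n) (ZMod 2) ↔
      ∀ v w : BitVec2 n, symp (A *ᵥ v) (A *ᵥ w) = symp v w := by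
  rw [SymplecticGroup.mem_iff']
  constructor
  · intro h v w
    rw [symp_mulVec, h, J_mulVec_dotProduct]
  · intro h
    ext i j
    have := h (Pi.single i 1) (Pi.single j 1)
    rw [symp_mulVec, ← J_mulVec_dotProduct] at this
    simpa using this

theorem symp_sp {n : ℕ} (U : Sp n) (v w : BitVec2 n) :
    symp (U.1 *ᵥ v) (U.1 *ᵥ w) = symp v w :=
  mem_symplecticGroup_iff_symp.mp U.2 v w

theorem Sp.mul_mulVec {n : ℕ} (U V : Sp n) (v : BitVec2 n) :
    (U * V).1 *ᵥ v = U.1 *ᵥ (V.1 *ᵥ v) := by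
  simp [Matrix.mulVec_mulVec]

theorem Sp.inv_mulVec {n : ℕ} (U : Sp n) (v : BitVec2 n) :
    (U⁻¹).1 *ᵥ (U.1 *ᵥ v) = v := by
  rw [← Sp.mul_mulVec, inv_mul_cancel]
  simp

theorem Sp.mulVec_inv {n : ℕ} (U : Sp n) (v : BitVec2 n) :
    U.1 *ᵥ ((U⁻¹).1 *ᵥ v) = v := by
  simpa using Sp.inv_mulVec U⁻¹ v

theorem Sp.mulVec_eq_iff {n : ℕ} (U : Sp n) (v w : BitVec2 n) :
    U.1 *ᵥ v = w ↔ v = (U⁻¹).1 *ᵥ w := by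
  constructor
  · rintro rfl
    rw [Sp.inv_mulVec]
  · rintro rfl
    rw [Sp.mulVec_inv]

theorem Sp.mulVec_ne_zero {n : ℕ} (U : Sp n) {v : BitVec2 n} (h : v ≠ 0) : U.1 *ᵥ v ≠ 0 := by
  rw [Ne, Sp.mulVec_eq_iff, Matrix.mulVec_zero]
  exact h

theorem transvection_mulVec_aux {n : ℕ} (c v : BitVec2 n) :
    (1 + Matrix.vecMulVec c (c ∘ Sum.swap)) *ᵥ v = v + symp v c • c := by
  rw [Matrix.add_mulVec, Matrix.one_mulVec, Matrix.vecMulVec_mulVec]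
  have : (c ∘ Sum.swap) ⬝ᵥ v = symp v c := by
    simp [dotProduct, symp, Finset.sum_add_distrib, mul_comm]
  ext i
  simp [this, mul_comm]

/-- The symplectic transvection `v ↦ v + ω(v,c) c`. -/
def transvection {n : ℕ} (c : BitVec2 n) : Sp n :=
  ⟨1 + Matrix.vecMulVec c (c ∘ Sum.swap), mem_symplecticGroup_iff_symp.mpr fun v w => by
    rw [transvection_mulVec_aux, transvection_mulVec_aux]
    rcases zmod2_cases (symp v c) with h | h <;> rcases zmod2_cases (symp w c) with h' | h' <;>
      simp [h, h', symp_add_left, symp_add_right, symp_self, symp_comm c, add_assoc,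
        CharTwo.add_self_eq_zero]⟩

theorem transvection_mulVec {n : ℕ} (c v : BitVec2 n) :
    (transvection c).1 *ᵥ v = v + symp v c • c :=
  transvection_mulVec_aux c v

theorem transvection_mulVec_of_symp_eq_zero {n : ℕ} {c v : BitVec2 n} (h : symp v c = 0) :
    (transvection c).1 *ᵥ v = v := by
  simp [transvection_mulVec, h]

theorem bitVec2_add_self {n : ℕ} (v : BitVec2 n) : v + v = 0 :=
  funext fun _ => CharTwo.add_self_eq_zero _

/-- The basic move: when ω(u, w) = 1, also ω(u, u + w) = 1, so the transvection along the difference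
adds it to u. -/
theorem transvection_add_mulVec {n : ℕ} {u w : BitVec2 n} (h : symp u w = 1) :
    (transvection (u + w)).1 *ᵥ u = w := by
  rw [transvection_mulVec, symp_add_right, symp_self, h, zero_add, one_smul, ← add_assoc,
    bitVec2_add_self, zero_add]

/-- `U` fixes every vector orthogonal to the vectors supported on `S`. -/
def FixesPerp {n : ℕ} (S : Finset (Fin n)) (U : Sp n) : Prop :=
  ∀ x, (∀ d, SupportedOn S d → symp x d = 0) → U.1 *ᵥ x = x

theorem FixesPerp.mul {n : ℕ} {S : Finset (Fin n)} {U V : Sp n} (hU : FixesPerp S U)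
    (hV : FixesPerp S V) : FixesPerp S (U * V) := fun x hx => by
  rw [Sp.mul_mulVec, hV x hx, hU x hx]

theorem fixesPerp_transvection {n : ℕ} {S : Finset (Fin n)} {c : BitVec2 n}
    (h : SupportedOn S c) : FixesPerp S (transvection c) := fun _ hx =>
  transvection_mulVec_of_symp_eq_zero (hx c h)

/-- Two basic moves u ↦ c ↦ w through a vector `c` orthogonal to neither. Directions supported on
`S` leave the other qubits untouched, as the induction over qubits requires. -/
theorem exists_mulVec_eq {n : ℕ} {G : Subgroup (Sp n)} (hG : ∀ c, transvection c ∈ G)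
    {S : Finset (Fin n)} {u w : BitVec2 n} (hSu : SupportedOn S u) (hSw : SupportedOn S w)
    (hu : u ≠ 0) (hw : w ≠ 0) : ∃ g ∈ G, FixesPerp S g ∧ g.1 *ᵥ u = w := by
  obtain ⟨c, hSc, hc, hc'⟩ := hSu.exists_symp_eq_one_both hSw hu hw
  refine ⟨_, G.mul_mem (hG (c + w)) (hG (u + c)),
    (fixesPerp_transvection (hSc.add hSw)).mul (fixesPerp_transvection (hSu.add hSc)), ?_⟩
  rw [Sp.mul_mulVec, transvection_add_mulVec hc, transvection_add_mulVec]
  rw [symp_comm, hc']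

/-- If ω(f, f') = 1, the transvection along f + f' works, its direction being orthogonal to e.
Otherwise the transvection along e first turns f into f + e, which does pair with f', and fixes e.
-/
theorem exists_mulVec_eq_of_symp {n : ℕ} {G : Subgroup (Sp n)} (hG : ∀ c, transvection c ∈ G)
    {S : Finset (Fin n)} {e f f' : BitVec2 n} (hSe : SupportedOn S e) (hSf : SupportedOn S f)
    (hSf' : SupportedOn S f') (h : symp e f = 1) (h' : symp e f' = 1) :
    ∃ g ∈ G, FixesPerp S g ∧ g.1 *ᵥ e = e ∧ g.1 *ᵥ f = f' := by
  have key : ∀ f₀, SupportedOn S f₀ → symp e f₀ = 1 → symp f₀ f' = 1 →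
      ∃ g ∈ G, FixesPerp S g ∧ g.1 *ᵥ e = e ∧ g.1 *ᵥ f₀ = f' := fun f₀ hS h0 h1 =>
    ⟨_, hG (f₀ + f'), fixesPerp_transvection (hS.add hSf'),
      transvection_mulVec_of_symp_eq_zero (by
        rw [symp_add_right, h0, h', CharTwo.add_self_eq_zero]), transvection_add_mulVec h1⟩
  rcases zmod2_cases (symp f f') with hf | hf
  · obtain ⟨g, hg, h1, h2, h3⟩ := key (f + e) (hSf.add hSe)
      (by rw [symp_add_right, h, symp_self, add_zero]) (by rw [symp_add_left, hf, h', zero_add])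
    refine ⟨_, G.mul_mem hg (hG e), h1.mul (fixesPerp_transvection hSe), ?_, ?_⟩
    · rw [Sp.mul_mulVec, transvection_mulVec_of_symp_eq_zero (symp_self e), h2]
    · rw [Sp.mul_mulVec, transvection_mulVec, symp_comm, h, one_smul, h3]
  · exact key f hSf h hf

/-- The symplectic group is generated by transvections. -/
theorem mem_of_transvection_mem {n : ℕ} {G : Subgroup (Sp n)} (hG : ∀ c, transvection c ∈ G)
    (U : Sp n) : U ∈ G := by
  -- Induction on the set of qubits whose basis vectors `U` may move; each step frees one qubit.
  suffices H : ∀ S : Finset (Fin n), ∀ U : Sp n,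
      (∀ j ∉ S, U.1 *ᵥ Pi.single (Sum.inl j) 1 = Pi.single (Sum.inl j) 1 ∧
        U.1 *ᵥ Pi.single (Sum.inr j) 1 = Pi.single (Sum.inr j) 1) → U ∈ G from
    H Finset.univ U fun j hj => absurd (Finset.mem_univ j) hj
  intro S
  induction S using Finset.induction_on with
  | empty =>
    intro U hU
    have : U = 1 := by
      apply Subtype.ext
      ext i j
      rcases j with j | j
      · have := congrFun (hU j (Finset.notMem_empty j)).1 i
        rw [Matrix.mulVec_single_one] at this
        simpa [Matrix.one_apply, Pi.single_apply] using this
      · have := congrFun (hU j (Finset.notMem_empty j)).2 i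
        rw [Matrix.mulVec_single_one] at this
        simpa [Matrix.one_apply, Pi.single_apply] using this
    rw [this]
    exact G.one_mem
  | insert k S hk ih =>
    intro U hU
    have hkS : k ∈ insert k S := Finset.mem_insert_self k S
    -- `U` preserves the form and fixes the basis vectors off the set, hence preserves their
    -- orthogonal complement, which consists of the vectors supported on the set.
    have supp : ∀ U : Sp n, (∀ j ∉ insert k S, U.1 *ᵥ Pi.single (Sum.inl j) 1 = Pi.single (Sum.inl j) 1 ∧
        U.1 *ᵥ Pi.single (Sum.inr j) 1 = Pi.single (Sum.inr j) 1) →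
        ∀ v, SupportedOn (insert k S) v → SupportedOn (insert k S) (U.1 *ᵥ v) := by
      intro U hU v hv j hj
      rw [← symp_single_inr (U.1 *ᵥ v), ← symp_single_inl (U.1 *ᵥ v)]
      constructor
      · conv_lhs => rw [← (hU j hj).2, symp_sp, symp_single_inr, (hv j hj).1]
      · conv_lhs => rw [← (hU j hj).1, symp_sp, symp_single_inl, (hv j hj).2]
    have fixed : ∀ g : Sp n, FixesPerp (insert k S) g → ∀ j ∉ insert k S,
        g.1 *ᵥ Pi.single (Sum.inl j) 1 = Pi.single (Sum.inl j) 1 ∧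
        g.1 *ᵥ Pi.single (Sum.inr j) 1 = Pi.single (Sum.inr j) 1 := fun g hg j hj =>
      ⟨hg _ fun d hd => by rw [symp_comm, symp_single_inl, (hd j hj).2],
        hg _ fun d hd => by rw [symp_comm, symp_single_inr, (hd j hj).1]⟩
    have hne : (Pi.single (Sum.inl k) 1 : BitVec2 n) ≠ 0 := by simp
    -- `g` returns the image of the X-vector of qubit `k` to its place; below, `g'` does the same
    -- for its Z-partner while keeping the X-vector fixed.
    obtain ⟨g, hg, hgp, hge⟩ := exists_mulVec_eq hG (supp U hU _ (supportedOn_inl hkS))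
      (supportedOn_inl hkS) (Sp.mulVec_ne_zero U hne) hne
    have hU1 : ∀ j ∉ insert k S, (g * U).1 *ᵥ Pi.single (Sum.inl j) 1 = Pi.single (Sum.inl j) 1 ∧
        (g * U).1 *ᵥ Pi.single (Sum.inr j) 1 = Pi.single (Sum.inr j) 1 := fun j hj => by
      rw [Sp.mul_mulVec, Sp.mul_mulVec, (hU j hj).1, (hU j hj).2]
      exact fixed g hgp j hj
    have hef : symp (Pi.single (Sum.inl k) 1 : BitVec2 n) (Pi.single (Sum.inr k) 1) = 1 := by
      simp [symp_single_inr]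
    obtain ⟨g', hg', hgp', hge', hgf'⟩ := exists_mulVec_eq_of_symp hG (supportedOn_inl hkS)
      (supp (g * U) hU1 _ (supportedOn_inr hkS)) (supportedOn_inr hkS)
      (by conv_lhs => rw [← hge, ← Sp.mul_mulVec, symp_sp, hef]) hef
    have hmem : g' * (g * U) ∈ G := by
      refine ih _ fun j hj => ?_
      rw [Sp.mul_mulVec g', Sp.mul_mulVec g']
      by_cases hjk : j = k
      · subst hjk
        rw [hgf', Sp.mul_mulVec, hge, hge']
        exact ⟨rfl, rfl⟩
      · have hj' : j ∉ insert k S := by simp [hjk, hj]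
        rw [(hU1 j hj').1, (hU1 j hj').2]
        exact fixed g' hgp' j hj'
    rwa [G.mul_mem_cancel_left hg', G.mul_mem_cancel_left hg] at hmem

/-- The symplectic group acts transitively on nonzero vectors. -/
theorem Sp.exists_mulVec_eq {n : ℕ} {u w : BitVec2 n} (hu : u ≠ 0) (hw : w ≠ 0) :
    ∃ U : Sp n, U.1 *ᵥ u = w :=
  let ⟨g, _, _, hg⟩ := CliffordDesign.exists_mulVec_eq (G := ⊤) (fun _ => Subgroup.mem_top _)
    (supportedOn_univ u) (supportedOn_univ w) hu hw
  ⟨g, hg⟩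

/-! ## Every symplectic matrix is implemented by a unitary -/

theorem inv_sqrt_two_mul_self : (Real.sqrt 2 : ℂ)⁻¹ * (Real.sqrt 2 : ℂ)⁻¹ * 2 = 1 := by
  rw [← mul_inv, ← Complex.ofReal_mul, Real.mul_self_sqrt zero_le_two]
  simp

theorem star_inv_sqrt_two : star (Real.sqrt 2 : ℂ)⁻¹ = (Real.sqrt 2 : ℂ)⁻¹ := by
  simp [Complex.conj_ofReal]

/-- The unitary `(1 + i O(c)) / √2`. -/
noncomputable def transvectionU {n : ℕ} (c : BitVec2 n) : UGroup n :=
  ⟨((Real.sqrt 2 : ℂ)⁻¹) • (1 + Complex.I • pauliOp c), by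
    rw [Matrix.mem_unitaryGroup_iff, star_smul, star_add, star_smul, star_one, pauliOp_star,
      Matrix.smul_mul, Matrix.mul_smul, smul_smul, star_inv_sqrt_two]
    have : (1 + Complex.I • pauliOp c) * (1 + star Complex.I • pauliOp c) = (2 : ℂ) • (1 : Op n) := by
      simp [add_mul, mul_add, smul_smul, pauliOp_sq, two_smul]
      abel
    rw [this, smul_smul, inv_sqrt_two_mul_self, one_smul]⟩

/-- Let V = (1 + i O(c))/√2. If O(v) commutes with O(c), it commutes with V. If they anticommute,
then O(v) V† = V O(v), so V O(v) V† = V² O(v) = i O(c) O(v), which is ±O(c + v). -/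
theorem implements_transvection {n : ℕ} (c : BitVec2 n) :
    Implements (transvectionU c) (transvection c) := by
  intro v
  have hu : (transvectionU c : Op n) * star (transvectionU c : Op n) = 1 :=
    Matrix.mem_unitaryGroup_iff.mp (transvectionU c).2
  rw [transvection_mulVec]
  rcases zmod2_cases (symp v c) with h | h
  · left
    have : (transvectionU c : Op n) * pauliOp v = pauliOp v * (transvectionU c : Op n) := by
      simp [transvectionU, add_mul, mul_add, pauliOp_comm c, symp_comm c, h, sgn_zero]
    rw [this, mul_assoc, hu, mul_one, h, zero_smul, add_zero]
  · have h' : pauliOp v * pauliOp c = -(pauliOp c * pauliOp v) := by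
      rw [pauliOp_comm, h, sgn_one, neg_one_smul]
    have hst : star (transvectionU c : Op n) =
        (Real.sqrt 2 : ℂ)⁻¹ • (1 - Complex.I • pauliOp c) := by
      rw [transvectionU, star_smul, star_inv_sqrt_two, star_add, star_smul, star_one, pauliOp_star]
      simp [sub_eq_add_neg]
    have : pauliOp v * star (transvectionU c : Op n) = (transvectionU c : Op n) * pauliOp v := by
      rw [hst, transvectionU, Matrix.mul_smul, Matrix.smul_mul, mul_sub, add_mul, Matrix.mul_smul,
        h', Matrix.smul_mul]
      simp
    have hsq : (transvectionU c : Op n) * (transvectionU c : Op n) = Complex.I • pauliOp c := by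
      have e : (1 + Complex.I • pauliOp c) * (1 + Complex.I • pauliOp c) =
          (2 : ℂ) • Complex.I • pauliOp c := by
        simp only [add_mul, mul_add, Matrix.smul_mul, Matrix.mul_smul, smul_smul, pauliOp_sq,
          Complex.I_mul_I, one_mul, mul_one]
        rw [two_mul, add_smul]
        module
      rw [transvectionU, Matrix.smul_mul, Matrix.mul_smul, smul_smul, e, smul_smul,
        inv_sqrt_two_mul_self, one_smul]
    rw [mul_assoc, this, ← mul_assoc, hsq, Matrix.smul_mul, h, one_smul, add_comm v]
    exact pauliOp_mul_of_anticomm (by rw [symp_comm, h])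

theorem exists_implements {n : ℕ} (U : Sp n) : ∃ V : UGroup n, Implements V U := by
  let G : Subgroup (Sp n) :=
    { carrier := {U | ∃ V : UGroup n, Implements V U}
      mul_mem' := by
        rintro _ _ ⟨V, hV⟩ ⟨V', hV'⟩
        exact ⟨_, hV.mul hV'⟩
      one_mem' := ⟨1, Implements.one⟩
      inv_mem' := by
        rintro _ ⟨V, hV⟩
        exact ⟨_, hV.inv⟩ }
  exact mem_of_transvection_mem (G := G) (fun c => ⟨_, implements_transvection c⟩) U

/-! ## The tableau homomorphism and its kernel -/

/-- The representative chosen by `tableau` differs from `V` by a scalar, which acts trivially under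
conjugation; uniqueness of the implemented matrix concludes. -/
theorem tableau_mk {n : ℕ} (V : cliffordUnitary n) {U : Sp n} (h : Implements (V : UGroup n) U) :
    tableau (QuotientGroup.mk V : Clifford n) = U := by
  obtain ⟨P, hP⟩ := QuotientGroup.mk_out_eq_mul (phase n) V
  obtain ⟨c, hc⟩ := P.2
  have hP1 : Implements ((P : cliffordUnitary n) : UGroup n) 1 := by
    intro v
    left
    have hu : (((P : cliffordUnitary n) : UGroup n) : Op n) *
        star (((P : cliffordUnitary n) : UGroup n) : Op n) = 1 :=
      Matrix.mem_unitaryGroup_iff.mp ((P : cliffordUnitary n) : UGroup n).2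
    have hcomm : (((P : cliffordUnitary n) : UGroup n) : Op n) * pauliOp v =
        pauliOp v * (((P : cliffordUnitary n) : UGroup n) : Op n) := by
      rw [hc]; simp
    rw [hcomm, mul_assoc, hu]
    simp
  have h1 : Implements (Clifford.rep (QuotientGroup.mk V)) (U * 1) := by
    have : Clifford.rep (QuotientGroup.mk V) =
        (V : UGroup n) * ((P : cliffordUnitary n) : UGroup n) :=
      congrArg (fun W : cliffordUnitary n => (W : UGroup n)) hP
    rw [this]
    exact h.mul hP1
  rw [mul_one] at h1
  exact (tableau_spec _).unique h1

theorem exists_tableau_eq {n : ℕ} (U : Sp n) : ∃ q : Clifford n, tableau q = U := by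
  obtain ⟨V, hV⟩ := exists_implements U
  exact ⟨QuotientGroup.mk ⟨V, U, hV⟩, tableau_mk ⟨V, U, hV⟩ hV⟩

theorem Clifford.mk_out {n : ℕ} (q : Clifford n) :
    (QuotientGroup.mk (Quotient.out q) : Clifford n) = q := Quotient.out_eq q

theorem tableau_mul {n : ℕ} (q q' : Clifford n) : tableau (q * q') = tableau q * tableau q' := by
  conv_lhs => rw [← Clifford.mk_out q, ← Clifford.mk_out q']
  exact tableau_mk _ ((tableau_spec q).mul (tableau_spec q'))

/-- The homomorphism from the Clifford group to the symplectic group. -/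
noncomputable def tableauHom (n : ℕ) : Clifford n →* Sp n := MonoidHom.mk' tableau tableau_mul

theorem tableau_inv {n : ℕ} (q : Clifford n) : tableau q⁻¹ = (tableau q)⁻¹ :=
  map_inv (tableauHom n) q

theorem tableau_pauli {n : ℕ} (w : BitVec2 n) : tableau (pauli w) = 1 :=
  tableau_mk _ fun v => by simpa [pauliU] using pauliOp_conj w v

theorem tableau_mul_pauli {n : ℕ} (q : Clifford n) (w : BitVec2 n) :
    tableau (q * pauli w) = tableau q := by
  rw [tableau_mul, tableau_pauli, mul_one]

/-- A unitary that maps every Pauli operator to itself up to sign is a Pauli operator up to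
phase. -/
theorem eq_smul_pauliOp_of_implements_one {n : ℕ} {V : UGroup n} (h : Implements V 1) :
    ∃ (w : BitVec2 n) (c : ℂ), (V : Op n) = c • pauliOp w := by
  have hV : star (V : Op n) * (V : Op n) = 1 := Matrix.UnitaryGroup.star_mul_self V
  have hV0 : (V : Op n) ≠ 0 := fun h0 => by simp [h0] at hV
  -- `w` is a label with nonzero coefficient in the Pauli expansion of `V`. Inserting O(v)² = 1 in
  -- this coefficient shows that `V` commutes with each O(v) up to the same sign as O(w), so O(w) V
  -- commutes with every Pauli operator and is scalar.
  obtain ⟨w, hw⟩ := exists_trace_ne_zero hV0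
  have hs : ∀ v, ∃ s : ℂ, (V : Op n) * pauliOp v = s • (pauliOp v * (V : Op n)) := by
    intro v
    have e : (V : Op n) * pauliOp v =
        ((V : Op n) * pauliOp v * star (V : Op n)) * (V : Op n) := by
      rw [mul_assoc _ (star _), hV, mul_one]
    rcases h v with k | k
    · exact ⟨1, by rw [e, k]; simp⟩
    · exact ⟨-1, by rw [e, k]; simp⟩
  have key : ∀ v, (V : Op n) * pauliOp v = sgn (symp w v) • (pauliOp v * (V : Op n)) := by
    intro v
    obtain ⟨s, hs⟩ := hs v
    have e1 : (pauliOp w * (V : Op n)).trace =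
        (s * sgn (symp w v)) * (pauliOp w * (V : Op n)).trace := by
      calc (pauliOp w * (V : Op n)).trace
          = (pauliOp w * ((V : Op n) * pauliOp v) * pauliOp v).trace := by
            rw [mul_assoc, mul_assoc (V : Op n), pauliOp_sq, mul_one]
        _ = s * (pauliOp v * pauliOp w * pauliOp v * (V : Op n)).trace := by
            rw [hs, Matrix.mul_smul, Matrix.smul_mul, Matrix.trace_smul, smul_eq_mul,
              Matrix.trace_mul_comm]
            simp only [mul_assoc]
        _ = _ := by
            rw [pauliOp_conj_eq, Matrix.smul_mul, Matrix.trace_smul, smul_eq_mul, symp_comm]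
            ring
    have e2 : s * sgn (symp w v) = 1 :=
      mul_right_cancel₀ hw (by rw [← e1, one_mul])
    have e3 : s = sgn (symp w v) := by
      calc s = s * (sgn (symp w v) * sgn (symp w v)) := by rw [sgn_mul_self, mul_one]
        _ = _ := by rw [← mul_assoc, e2, one_mul]
    rw [hs, e3]
  obtain ⟨c, hc⟩ := scalar_of_commute (pauliOp w * (V : Op n)) fun v => by
    rw [mul_assoc, key, Matrix.mul_smul, ← mul_assoc, pauliOp_comm w v, Matrix.smul_mul, smul_smul,
      sgn_mul_self, one_smul, mul_assoc]
  refine ⟨w, c, ?_⟩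
  calc (V : Op n) = pauliOp w * (pauliOp w * (V : Op n)) := by
        rw [← mul_assoc, pauliOp_sq, one_mul]
    _ = _ := by rw [hc]; simp

theorem exists_pauli_of_tableau_eq_one {n : ℕ} {q : Clifford n} (h : tableau q = 1) :
    ∃ w, q = pauli w := by
  obtain ⟨w, c, hw⟩ := eq_smul_pauliOp_of_implements_one (h ▸ tableau_spec q)
  refine ⟨w, ?_⟩
  rw [← Clifford.mk_out q]
  symm
  unfold pauli
  rw [QuotientGroup.eq]
  refine ⟨c, ?_⟩
  change star (pauliOp w) * (q.rep : Op n) = c • 1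
  rw [hw, pauliOp_star, Matrix.mul_smul, pauliOp_sq]

theorem tableau_eq_iff {n : ℕ} {q q' : Clifford n} :
    tableau q' = tableau q ↔ ∃ w, q' = q * pauli w := by
  constructor
  · intro h
    obtain ⟨w, hw⟩ := exists_pauli_of_tableau_eq_one (q := q⁻¹ * q')
      (by rw [tableau_mul, tableau_inv, h, inv_mul_cancel])
    exact ⟨w, by rw [← hw, mul_inv_cancel_left]⟩
  · rintro ⟨w, rfl⟩
    exact tableau_mul_pauli q w

theorem pauli_injective {n : ℕ} : Function.Injective (pauli : BitVec2 n → Clifford n) := by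
  intro v w h
  obtain ⟨c, hc⟩ := QuotientGroup.eq.mp h
  have hc' : pauliOp v * pauliOp w = c • (1 : Op n) := by
    have : star (pauliOp v) * pauliOp w = c • (1 : Op n) := hc
    rwa [pauliOp_star] at this
  by_contra hvw
  have ht := pauliOp_trace_mul v w
  rw [hc', if_neg hvw] at ht
  have hc0 : c = 0 := by simpa using ht
  rw [hc0, zero_smul] at hc'
  have := congrArg (fun M => pauliOp v * M) hc'
  simp only [← mul_assoc, pauliOp_sq, one_mul, mul_zero] at this
  exact pauliOp_ne_zero w this

theorem card_bitVec2 (n : ℕ) : Fintype.card (BitVec2 n) = 4 ^ n := by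
  simp [BitVec2, ← two_mul, pow_mul, ZMod.card]

-- The fibres of `tableau` are the cosets of the Pauli operators, and distinct labels give distinct
-- elements.
open Classical in
theorem sum_tableau_eq {n : ℕ} {M : Type*} [AddCommMonoid M] (F : Clifford n → M)
    (q : Clifford n) :
    ∑ q' with tableau q' = tableau q, F q' = ∑ w : BitVec2 n, F (q * pauli w) := by
  symm
  refine Finset.sum_bij (fun w _ => q * pauli w) ?_ ?_ ?_ ?_
  · intro w _
    simp [tableau_mul_pauli]
  · intro v _ w _ h
    exact pauli_injective (mul_left_cancel h)
  · intro q' hq'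
    obtain ⟨w, hw⟩ := tableau_eq_iff.mp (Finset.mem_filter.mp hq').2
    exact ⟨w, Finset.mem_univ w, hw.symm⟩
  · intros; rfl

/-! ## Induced distributions -/

theorem sum_induced_mul {n : ℕ} (μ : Clifford n → ℝ) (F : Sp n → ℝ) :
    ∑ U, induced μ U * F U = ∑ q, μ q * F (tableau q) := by
  classical
  rw [← Finset.sum_fiberwise Finset.univ tableau fun q => μ q * F (tableau q)]
  refine Finset.sum_congr rfl fun U _ => ?_
  rw [induced, Finset.sum_mul]
  refine Finset.sum_congr ?_ fun q hq => ?_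
  · ext; simp
  · rw [(Finset.mem_filter.mp hq).2]

theorem isProb_induced {n : ℕ} {μ : Clifford n → ℝ} (h : IsProb μ) : IsProb (induced μ) :=
  ⟨fun _ => Finset.sum_nonneg fun q _ => h.1 q, by
    simpa [h.2] using sum_induced_mul μ fun _ => 1⟩

theorem induced_tableau {n : ℕ} {μ : Clifford n → ℝ} (h : PauliInvariant μ) (q : Clifford n) :
    induced μ (tableau q) = 4 ^ n * μ q := by
  rw [induced, sum_tableau_eq, Finset.sum_congr rfl fun w _ => (h q w).symm]
  rw [Finset.sum_const, Finset.card_univ, card_bitVec2, nsmul_eq_mul]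
  simp

theorem pauliInvariant_pauliLift {n : ℕ} (π : Sp n → ℝ) : PauliInvariant (pauliLift π) :=
  fun q w => by simp only [pauliLift, tableau_mul_pauli]

theorem induced_pauliLift {n : ℕ} (π : Sp n → ℝ) : induced (pauliLift π) = π := by
  funext U
  obtain ⟨q, rfl⟩ := exists_tableau_eq U
  rw [induced_tableau (pauliInvariant_pauliLift π), pauliLift]
  field_simp

theorem isProb_pauliLift {n : ℕ} {π : Sp n → ℝ} (h : IsProb π) : IsProb (pauliLift π) :=
  ⟨fun q => div_nonneg (h.1 _) (by positivity), by
    have := sum_induced_mul (pauliLift π) fun _ => 1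
    simp only [induced_pauliLift, mul_one, h.2] at this
    exact this.symm⟩

/-! ## The second moment of the Haar measure on Pauli operators -/

instance isProbabilityMeasure_haar (n : ℕ) : MeasureTheory.IsProbabilityMeasure (haar n) :=
  ⟨MeasureTheory.Measure.haarMeasure_self (K₀ := ⊤)⟩

instance isMulLeftInvariant_haar (n : ℕ) : (haar n).IsMulLeftInvariant := by
  unfold haar
  infer_instance

/-- The Haar average of `(V† A V) ⊗ (V† B V)`. -/
noncomputable def haarTwirl {n : ℕ} (A B : Op n) :
    Matrix (Basis n × Basis n) (Basis n × Basis n) ℂ :=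
  Matrix.of fun a b => ∫ V, twirlTerm A B V a b ∂(haar n)

theorem continuous_conj {n : ℕ} (A : Op n) :
    Continuous fun V : UGroup n => star (V : Op n) * A * (V : Op n) :=
  (continuous_subtype_val.star.mul continuous_const).mul continuous_subtype_val

theorem integrable_twirlTerm {n : ℕ} (A B : Op n) (a b : Basis n × Basis n) :
    MeasureTheory.Integrable (fun V => twirlTerm A B V a b) (haar n) := by
  have : Continuous fun V => twirlTerm A B V a b :=
    ((continuous_conj A).matrix_elem a.1 b.1).mul ((continuous_conj B).matrix_elem a.2 b.2)
  exact this.integrable_of_hasCompactSupport (HasCompactSupport.of_compactSpace _)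

theorem twirlTerm_mul {n : ℕ} (A B : Op n) (W V : UGroup n) :
    twirlTerm A B (W * V) =
      twirlTerm (star (W : Op n) * A * (W : Op n)) (star (W : Op n) * B * (W : Op n)) V := by
  simp only [twirlTerm, Submonoid.coe_mul, star_mul, mul_assoc]

theorem twirlTerm_smul {n : ℕ} (c d : ℂ) (A B : Op n) (V : UGroup n) :
    twirlTerm (c • A) (d • B) V = (c * d) • twirlTerm A B V := by
  simp only [twirlTerm, Matrix.mul_smul, Matrix.smul_mul, Matrix.smul_kronecker,
    Matrix.kronecker_smul, smul_smul, mul_comm]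

theorem twirlTerm_sum {n : ℕ} {ι : Type*} (s : Finset ι) (A B : ι → Op n) (V : UGroup n) :
    twirlTerm (∑ i ∈ s, A i) (∑ i ∈ s, B i) V = ∑ i ∈ s, ∑ j ∈ s, twirlTerm (A i) (B j) V := by
  ext a b
  simp only [twirlTerm, Finset.mul_sum, Finset.sum_mul, Matrix.kroneckerMap_apply,
    Matrix.sum_apply]
  rw [Finset.sum_comm]

theorem twirlTerm_eq_conj {n : ℕ} (A B : Op n) (V : UGroup n) :
    twirlTerm A B V =
      (star (V : Op n) ⊗ₖ star (V : Op n)) * (A ⊗ₖ B) * ((V : Op n) ⊗ₖ (V : Op n)) := by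
  rw [← Matrix.mul_kronecker_mul, ← Matrix.mul_kronecker_mul, twirlTerm]

theorem haarTwirl_conj {n : ℕ} (A B : Op n) (W : UGroup n) :
    haarTwirl (star (W : Op n) * A * (W : Op n)) (star (W : Op n) * B * (W : Op n)) =
      haarTwirl A B := by
  ext a b
  simp only [haarTwirl, Matrix.of_apply, ← twirlTerm_mul]
  exact MeasureTheory.integral_mul_left_eq_self (fun V => twirlTerm A B V a b) W

theorem haarTwirl_smul {n : ℕ} (c d : ℂ) (A B : Op n) :
    haarTwirl (c • A) (d • B) = (c * d) • haarTwirl A B := by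
  ext a b
  simp only [haarTwirl, Matrix.of_apply, twirlTerm_smul, Matrix.smul_apply, smul_eq_mul]
  exact MeasureTheory.integral_const_mul _ _

theorem haarTwirl_sum {n : ℕ} {ι : Type*} (s : Finset ι) (A B : ι → Op n) :
    haarTwirl (∑ i ∈ s, A i) (∑ i ∈ s, B i) = ∑ i ∈ s, ∑ j ∈ s, haarTwirl (A i) (B j) := by
  ext a b
  simp only [haarTwirl, Matrix.of_apply, twirlTerm_sum, Matrix.sum_apply]
  rw [MeasureTheory.integral_finsetSum _ fun i _ =>
    MeasureTheory.integrable_finsetSum _ fun j _ => integrable_twirlTerm _ _ _ _]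
  exact Finset.sum_congr rfl fun i _ =>
    MeasureTheory.integral_finsetSum _ fun j _ => integrable_twirlTerm _ _ _ _

theorem twirlTerm_one {n : ℕ} (V : UGroup n) : twirlTerm (1 : Op n) 1 V = 1 := by
  have hV : star (V : Op n) * (V : Op n) = 1 := Matrix.UnitaryGroup.star_mul_self V
  rw [twirlTerm, mul_one, hV, Matrix.one_kronecker_one]

theorem haarTwirl_one {n : ℕ} : haarTwirl (1 : Op n) 1 = 1 := by
  ext a b
  simp [haarTwirl, twirlTerm_one]

theorem matrix_eq_zero_of_eq_neg {ι κ : Type*} {M : Matrix ι κ ℂ} (h : M = -M) : M = 0 := by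
  ext i j
  exact self_eq_neg.mp (congrFun (congrFun h i) j)

theorem pauliU_conj {n : ℕ} (w a : BitVec2 n) :
    star (pauliU w : Op n) * pauliOp a * (pauliU w : Op n) = sgn (symp w a) • pauliOp a := by
  change star (pauliOp w) * pauliOp a * pauliOp w = _
  rw [pauliOp_star, pauliOp_conj_eq]

theorem exists_sgn_mul_eq_neg_one {n : ℕ} {a b : BitVec2 n} (h : a ≠ b) :
    ∃ w, sgn (symp w a) * sgn (symp w b) = -1 := by
  have hab : a + b ≠ 0 := fun h0 => h (by
    have := congrArg (· + b) h0
    simpa [add_assoc, bitVec2_add_self] using this)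
  obtain ⟨w, hw⟩ := exists_symp_eq_one hab
  exact ⟨w, by rw [← sgn_add, ← symp_add_right, symp_comm, hw, sgn_one]⟩

/-- Some O(w) commutes with exactly one of O(a), O(b). Left invariance under it shows that the
average equals its own negative. -/
theorem haarTwirl_pauliOp_of_ne {n : ℕ} {a b : BitVec2 n} (h : a ≠ b) :
    haarTwirl (pauliOp a) (pauliOp b) = 0 := by
  obtain ⟨w, hw⟩ := exists_sgn_mul_eq_neg_one h
  have := haarTwirl_conj (pauliOp a) (pauliOp b) (pauliU w)
  rw [pauliU_conj, pauliU_conj, haarTwirl_smul, hw, neg_one_smul] at this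
  exact matrix_eq_zero_of_eq_neg this.symm

theorem kronecker_self_of_eq_or_neg {n : ℕ} {A B : Op n} (h : A = B ∨ A = -B) :
    A ⊗ₖ A = B ⊗ₖ B := by
  rcases h with rfl | rfl
  · rfl
  · ext; simp [Matrix.kroneckerMap_apply]

theorem haarTwirl_neg {n : ℕ} (A : Op n) : haarTwirl (-A) (-A) = haarTwirl A A := by
  have := haarTwirl_smul (-1) (-1) A A
  simpa using this

/-- A Clifford unitary carries O(a) to ±O(b), and left invariance absorbs it. The inverse V⁻¹
appears because the twirl conjugates in the opposite direction to `Implements`. -/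
theorem haarTwirl_pauliOp_congr {n : ℕ} {a b : BitVec2 n} (ha : a ≠ 0) (hb : b ≠ 0) :
    haarTwirl (pauliOp a) (pauliOp a) = haarTwirl (pauliOp b) (pauliOp b) := by
  obtain ⟨U, rfl⟩ := Sp.exists_mulVec_eq ha hb
  obtain ⟨V, hV⟩ := exists_implements U
  have e : star ((V⁻¹ : UGroup n) : Op n) * pauliOp a * ((V⁻¹ : UGroup n) : Op n) =
      (V : Op n) * pauliOp a * star (V : Op n) := by
    have : ((V⁻¹ : UGroup n) : Op n) = star (V : Op n) := rfl
    rw [this, star_star]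
  rw [← haarTwirl_conj (pauliOp a) (pauliOp a) V⁻¹, e]
  rcases hV a with h | h <;> rw [h]
  rw [haarTwirl_neg]

/-- The sum of O(v) ⊗ O(v) commutes with V ⊗ V, so its conjugates do not depend on V and averaging
does nothing. -/
theorem sum_haarTwirl_pauliOp {n : ℕ} :
    ∑ v : BitVec2 n, haarTwirl (pauliOp v) (pauliOp v) = ∑ v : BitVec2 n, pauliOp v ⊗ₖ pauliOp v := by
  have h : ∀ V : UGroup n, ∑ v : BitVec2 n, twirlTerm (pauliOp v) (pauliOp v) V =
      ∑ v : BitVec2 n, pauliOp v ⊗ₖ pauliOp v := fun V => by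
    have hV : star (V : Op n) * (V : Op n) = 1 := Matrix.UnitaryGroup.star_mul_self V
    simp only [twirlTerm_eq_conj, ← Finset.mul_sum, ← Finset.sum_mul]
    rw [mul_assoc, sum_pauliOp_kronecker_comm, ← mul_assoc, ← Matrix.mul_kronecker_mul, hV,
      Matrix.one_kronecker_one, one_mul]
  ext a b
  have h' : ∀ V : UGroup n, ∑ v : BitVec2 n, twirlTerm (pauliOp v) (pauliOp v) V a b =
      (∑ v : BitVec2 n, pauliOp v ⊗ₖ pauliOp v) a b := fun V => by rw [← h V, Matrix.sum_apply]
  rw [Matrix.sum_apply]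
  simp only [haarTwirl, Matrix.of_apply]
  rw [← MeasureTheory.integral_finsetSum _ fun v _ => integrable_twirlTerm _ _ _ _]
  simp only [h']
  simp

-- The label 0 contributes 1 to both sides of `sum_haarTwirl_pauliOp`; after cancelling it, the left
-- side is 4^n - 1 equal terms.
open Classical in
theorem haarTwirl_pauliOp_self {n : ℕ} {a : BitVec2 n} (ha : a ≠ 0) :
    haarTwirl (pauliOp a) (pauliOp a) =
      (1 / (4 ^ n - 1) : ℂ) • ∑ y : BitVec2 n with y ≠ 0, pauliOp y ⊗ₖ pauliOp y := by
  have h := sum_haarTwirl_pauliOp (n := n)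
  rw [← Finset.add_sum_erase _ _ (Finset.mem_univ (0 : BitVec2 n)),
    ← Finset.add_sum_erase _ _ (Finset.mem_univ (0 : BitVec2 n)), pauliOp_zero, haarTwirl_one,
    Matrix.one_kronecker_one, add_right_inj] at h
  have h1 : ∑ v ∈ Finset.univ.erase (0 : BitVec2 n), haarTwirl (pauliOp v) (pauliOp v) =
      (4 ^ n - 1 : ℂ) • haarTwirl (pauliOp a) (pauliOp a) := by
    rw [Finset.sum_congr rfl fun v hv => haarTwirl_pauliOp_congr (Finset.ne_of_mem_erase hv) ha,
      Finset.sum_const, Finset.card_erase_of_mem (Finset.mem_univ _), Finset.card_univ,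
      card_bitVec2, ← Nat.cast_smul_eq_nsmul ℂ, Nat.cast_sub (Nat.one_le_pow _ _ (by norm_num))]
    simp
  -- A nonzero label exists, which excludes n = 0.
  have hne : (4 ^ n - 1 : ℂ) ≠ 0 := by
    intro h0
    have h4 : ((4 ^ n : ℕ) : ℂ) = ((1 : ℕ) : ℂ) := by
      push_cast
      exact sub_eq_zero.mp h0
    have hcard : Fintype.card (BitVec2 n) = 1 := by rw [card_bitVec2]; exact_mod_cast h4
    exact ha (Fintype.card_le_one_iff.mp hcard.le a 0)
  rw [Finset.filter_ne', ← h, h1, smul_smul, one_div, inv_mul_cancel₀ hne, one_smul]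

/-! ## 2-designs and Pauli mixing -/

theorem isUnitary2Design_iff {n : ℕ} {ι : Type} [Fintype ι] (D : ι → UGroup n) (μ : ι → ℝ) :
    IsUnitary2Design D μ ↔ ∀ a b : BitVec2 n,
      ∑ i, (μ i : ℂ) • twirlTerm (pauliOp a) (pauliOp b) (D i) =
        haarTwirl (pauliOp a) (pauliOp b) := by
  refine ⟨fun h a b => h _ _, fun h A B => ?_⟩
  change _ = haarTwirl A B
  rw [pauliOp_expand A, pauliOp_expand B, haarTwirl_sum]
  simp only [twirlTerm_sum, twirlTerm_smul, haarTwirl_smul, Finset.smul_sum, ← h]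
  rw [Finset.sum_comm]
  refine Finset.sum_congr rfl fun a _ => ?_
  rw [Finset.sum_comm]
  refine Finset.sum_congr rfl fun b _ => Finset.sum_congr rfl fun i _ => ?_
  rw [smul_comm]

/-- The unknown sign of the conjugated operator occurs in both tensor factors and cancels. -/
theorem twirlTerm_pauliOp_self {n : ℕ} (a : BitVec2 n) {V : UGroup n} {U : Sp n}
    (h : Implements V U) :
    twirlTerm (pauliOp a) (pauliOp a) V =
      pauliOp ((U⁻¹).1 *ᵥ a) ⊗ₖ pauliOp ((U⁻¹).1 *ᵥ a) := by
  refine kronecker_self_of_eq_or_neg ?_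
  have := h.inv a
  have e : ((V⁻¹ : UGroup n) : Op n) = star (V : Op n) := rfl
  rwa [e, star_star] at this

theorem trace_kronecker_pauliOp {n : ℕ} (x y : BitVec2 n) :
    ((pauliOp x ⊗ₖ pauliOp x) * (pauliOp y ⊗ₖ pauliOp y)).trace =
      if x = y then (4 ^ n : ℂ) else 0 := by
  rw [← Matrix.mul_kronecker_mul, Matrix.trace_kronecker, pauliOp_trace_mul]
  split_ifs
  · rw [← mul_pow]; norm_num
  · simp

open Classical in
theorem sum_induced_eq {n : ℕ} (μ : Clifford n → ℝ) (x y : BitVec2 n) :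
    ∑ U : Sp n with U.1 *ᵥ x = y, induced μ U =
      ∑ q, μ q * if ((tableau q)⁻¹).1 *ᵥ y = x then 1 else 0 := by
  rw [← sum_induced_mul μ fun U => if (U⁻¹).1 *ᵥ y = x then (1 : ℝ) else 0, Finset.sum_filter]
  refine Finset.sum_congr rfl fun U _ => ?_
  rw [mul_ite, mul_one, mul_zero]
  exact if_congr (by rw [Sp.mulVec_eq_iff, eq_comm]) rfl rfl

/-- The operators O(y) ⊗ O(y) are orthogonal for the trace form. Pairing the identity for A = B =
O(y) with O(x) ⊗ O(x) isolates Pr[U⁻¹ y = x]. -/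
theorem IsUnitary2Design.pauliMixing {n : ℕ} {μ : Clifford n → ℝ}
    (h : IsUnitary2Design Clifford.rep μ) : PauliMixing (induced μ) := by
  classical
  intro x y hx hy
  have h1 := (isUnitary2Design_iff _ _).mp h y y
  rw [haarTwirl_pauliOp_self hy] at h1
  have h2 := congrArg (fun M => ((pauliOp x ⊗ₖ pauliOp x) * M).trace) h1
  simp only [twirlTerm_pauliOp_self y (tableau_spec _), Finset.mul_sum, Matrix.mul_smul,
    Matrix.trace_sum, Matrix.trace_smul, trace_kronecker_pauliOp] at h2
  have h3 : (4 ^ n : ℂ) ≠ 0 := pow_ne_zero n (by norm_num)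
  rw [Finset.sum_ite_eq, if_pos (by simpa using hx)] at h2
  have h4 : ∑ q, (μ q : ℂ) * (if ((tableau q)⁻¹).1 *ᵥ y = x then 1 else 0) = 1 / (4 ^ n - 1) := by
    apply mul_right_cancel₀ h3
    rw [smul_eq_mul] at h2
    rw [← h2, Finset.sum_mul]
    refine Finset.sum_congr rfl fun q _ => ?_
    rw [smul_eq_mul, mul_assoc, ite_mul, one_mul, zero_mul]
    simp only [eq_comm]
  rw [sum_induced_eq, ← Complex.ofReal_inj]
  push_cast
  rw [← h4]
  simp only [apply_ite Complex.ofReal, Complex.ofReal_one, Complex.ofReal_zero]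

/-- Mixing settles the terms a = b ≠ 0 and normalization the term a = b = 0. For a ≠ b the Haar
average is zero, and Pauli invariance makes the finite sum equal to its negative. -/
theorem PauliMixing.isUnitary2Design {n : ℕ} {μ : Clifford n → ℝ} (hμ : IsProb μ)
    (hP : PauliInvariant μ) (h : PauliMixing (induced μ)) : IsUnitary2Design Clifford.rep μ := by
  classical
  rw [isUnitary2Design_iff]
  intro a b
  by_cases hab : a = b
  · subst hab
    by_cases ha : a = 0
    · subst ha
      simp only [pauliOp_zero, twirlTerm_one, haarTwirl_one]
      rw [← Finset.sum_smul, ← Complex.ofReal_sum, hμ.2, Complex.ofReal_one, one_smul]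
    · rw [haarTwirl_pauliOp_self ha, Finset.smul_sum]
      have e : ∀ q : Clifford n, (μ q : ℂ) • twirlTerm (pauliOp a) (pauliOp a) q.rep =
          ∑ y : BitVec2 n with y ≠ 0, ((μ q * if ((tableau q)⁻¹).1 *ᵥ a = y then 1 else 0 : ℝ) : ℂ) •
            (pauliOp y ⊗ₖ pauliOp y) := by
        intro q
        rw [twirlTerm_pauliOp_self a (tableau_spec _),
          Finset.sum_eq_single_of_mem (((tableau q)⁻¹).1 *ᵥ a)
            (by simpa using Sp.mulVec_ne_zero _ ha)]
        · simp
        · intro y _ hy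
          rw [if_neg (Ne.symm hy)]
          simp
      simp only [e]
      rw [Finset.sum_comm]
      refine Finset.sum_congr rfl fun y hy => ?_
      rw [← Finset.sum_smul, ← Complex.ofReal_sum, ← sum_induced_eq,
        h y a (Finset.mem_filter.mp hy).2 ha]
      push_cast
      rfl
  · rw [haarTwirl_pauliOp_of_ne hab]
    obtain ⟨w, hw⟩ := exists_sgn_mul_eq_neg_one hab
    -- Invariance is assumed on the right but used on the left: O(w) q and q have the same tableau,
    -- so O(w) q = q O(w') for some w'.
    have hinv : ∀ q, μ (pauli w * q) = μ q := fun q => by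
      obtain ⟨w', hw'⟩ := tableau_eq_iff.mp
        (show tableau (pauli w * q) = tableau q by rw [tableau_mul, tableau_pauli, one_mul])
      rw [hw', ← hP]
    have ht : ∀ q : Clifford n, twirlTerm (pauliOp a) (pauliOp b) (pauli w * q).rep =
        -twirlTerm (pauliOp a) (pauliOp b) q.rep := fun q => by
      have : twirlTerm (pauliOp a) (pauliOp b) (pauli w * q).rep =
          twirlTerm (pauliOp a) (pauliOp b) (pauliU w * q.rep) := by
        conv_lhs => rw [← Clifford.mk_out q]
        exact twirlTerm_rep _ _ _
      rw [this, twirlTerm_mul, pauliU_conj, pauliU_conj, twirlTerm_smul, hw, neg_one_smul]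
    have hs : ∑ q, (μ q : ℂ) • twirlTerm (pauliOp a) (pauliOp b) q.rep =
        -∑ q, (μ q : ℂ) • twirlTerm (pauliOp a) (pauliOp b) q.rep := by
      conv_lhs => rw [← Equiv.sum_comp (Equiv.mulLeft (pauli w))]
      simp only [Equiv.coe_mulLeft, hinv, ht, smul_neg, Finset.sum_neg_distrib]
    exact matrix_eq_zero_of_eq_neg hs

/-! ## Tableaux of gates -/

theorem tab_h_mulVec {n : ℕ} (k : Fin n) (v : BitVec2 n) :
    (Gate.h k).tab *ᵥ v = v ∘ Equiv.swap (Sum.inl k) (Sum.inr k) := by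
  ext i
  simp only [Gate.tab, Matrix.mulVec, dotProduct, Matrix.submatrix_apply, Matrix.one_apply, id,
    ite_mul, one_mul, zero_mul, Function.comp]
  have : ∀ j, (i = Equiv.swap (Sum.inl k) (Sum.inr k) j) ↔
      (j = Equiv.swap (Sum.inl k) (Sum.inr k) i) := fun j => by
    constructor <;> (rintro rfl; simp)
  simp [this]

theorem tab_p_mulVec {n : ℕ} (k : Fin n) (v : BitVec2 n) :
    (Gate.p k).tab *ᵥ v = v + Pi.single (Sum.inl k) (v (Sum.inr k)) := by
  rw [Gate.tab, Matrix.add_mulVec, Matrix.one_mulVec, Matrix.single_mulVec]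
  ext i
  simp [Pi.single, Function.update_apply]

theorem tab_cnot_mulVec {n : ℕ} (c t : Fin n) (h : c ≠ t) (v : BitVec2 n) :
    (Gate.cnot c t h).tab *ᵥ v =
      v + Pi.single (Sum.inl c) (v (Sum.inl t)) + Pi.single (Sum.inr t) (v (Sum.inr c)) := by
  rw [Gate.tab, Matrix.add_mulVec, Matrix.add_mulVec, Matrix.one_mulVec, Matrix.single_mulVec,
    Matrix.single_mulVec]
  ext i
  simp [Pi.single, Function.update_apply]

/-- Phase and Hadamard tableaux are transvections, which shows that they are symplectic, so that
`localGroup` really contains them. -/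
theorem transvection_eq_tab_p {n : ℕ} (k : Fin n) :
    (transvection (Pi.single (Sum.inl k) 1)).1 = (Gate.p k).tab := by
  refine Matrix.mulVec_injective (funext fun v => ?_)
  rw [transvection_mulVec, tab_p_mulVec, symp_single_inl, ← Pi.single_smul, smul_eq_mul, mul_one]

theorem transvection_eq_tab_h {n : ℕ} (k : Fin n) :
    (transvection (Pi.single (Sum.inl k) 1 + Pi.single (Sum.inr k) 1)).1 = (Gate.h k).tab := by
  refine Matrix.mulVec_injective (funext fun v => ?_)
  rw [transvection_mulVec, tab_h_mulVec, symp_add_right, symp_single_inl, symp_single_inr]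
  have h2 : ∀ x y : ZMod 2, x + (y + x) = y ∧ x + (x + y) = y := by decide
  ext (j | j) <;> by_cases hj : j = k
  · subst hj; simp [h2]
  · simp [hj, Equiv.swap_apply_of_ne_of_ne]
  · subst hj; simp [h2]
  · simp [hj, Equiv.swap_apply_of_ne_of_ne]

theorem tab_h_mul_self {n : ℕ} (k : Fin n) : (Gate.h k).tab * (Gate.h k).tab = 1 := by
  refine Matrix.mulVec_injective (funext fun v => ?_)
  rw [← Matrix.mulVec_mulVec, tab_h_mulVec, tab_h_mulVec]
  ext i
  simp

/-- A circuit whose tableau is the action of a gate on Pauli operators (`Gate.tab` is the transpose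
of that action). -/
def Gate.dual {n : ℕ} : Gate n → List (Gate n)
  | .h k => [.h k]
  | .p k => [.h k, .p k, .h k]
  | .cnot c t hct => [.cnot t c hct.symm]

theorem prod_map_flatMap {α M : Type*} [Monoid M] (F : α → M) (d : α → List α) (c : List α) :
    ((c.flatMap d).map F).prod = (c.map fun g => ((d g).map F).prod).prod := by
  induction c with
  | nil => simp
  | cons g c ih => simp [ih]

theorem cnotCount_append {n : ℕ} (c d : List (Gate n)) :
    cnotCount (c ++ d) = cnotCount c + cnotCount d := by
  simp [cnotCount]

theorem cnotCount_flatMap_dual {n : ℕ} (c : List (Gate n)) :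
    cnotCount (c.flatMap Gate.dual) = cnotCount c := by
  induction c with
  | nil => rfl
  | cons g c ih =>
    rw [List.flatMap_cons, cnotCount_append, ih]
    cases g <;> simp [cnotCount, Gate.dual, Gate.cost]

/-- The action of a gate on Pauli operators. -/
noncomputable def Gate.act {n : ℕ} (g : Gate n) : Matrix (Fin n ⊕ Fin n) (Fin n ⊕ Fin n) (ZMod 2) :=
  (g.dual.map Gate.tab).prod

/-- Dualizing twice gives back the original matrix, so circuits translate in both directions between
tableaux and actions. -/
theorem prod_act_dual {n : ℕ} (g : Gate n) : (g.dual.map Gate.act).prod = g.tab := by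
  cases g with
  | h k => simp [Gate.dual, Gate.act]
  | p k =>
    simp only [Gate.dual, Gate.act, List.map_cons, List.map_nil, List.prod_cons, List.prod_nil,
      mul_one]
    simp only [mul_assoc, tab_h_mul_self, mul_one]
    rw [← mul_assoc, tab_h_mul_self, one_mul]
  | cnot c t h => simp [Gate.dual, Gate.act]

theorem act_p_mulVec {n : ℕ} (k : Fin n) (v : BitVec2 n) :
    (Gate.p k).act *ᵥ v = v + Pi.single (Sum.inr k) (v (Sum.inl k)) := by
  simp only [Gate.act, Gate.dual, List.map_cons, List.map_nil, List.prod_cons, List.prod_nil,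
      mul_one]
  rw [← Matrix.mulVec_mulVec, ← Matrix.mulVec_mulVec, tab_h_mulVec, tab_h_mulVec, tab_p_mulVec]
  ext (j | j) <;> by_cases hj : j = k
  · subst hj; simp
  · simp [hj, Equiv.swap_apply_of_ne_of_ne]
  · subst hj; simp
  · simp [hj, Equiv.swap_apply_of_ne_of_ne]

/-! ## Unitary matrices of gates -/

/-- Conjugation by `V` acts on Pauli operators as the binary matrix `M` up to signs. -/
def ActsAs {n : ℕ} (V : Op n) (M : Matrix (Fin n ⊕ Fin n) (Fin n ⊕ Fin n) (ZMod 2)) : Prop :=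
  ∀ v : BitVec2 n, V * pauliOp v * star V = pauliOp (M *ᵥ v) ∨
    V * pauliOp v * star V = -pauliOp (M *ᵥ v)

theorem ActsAs.mul {n : ℕ} {V V' : Op n} {M M' : Matrix (Fin n ⊕ Fin n) (Fin n ⊕ Fin n) (ZMod 2)}
    (h : ActsAs V M) (h' : ActsAs V' M') : ActsAs (V * V') (M * M') := by
  intro v
  have e : V * V' * pauliOp v * star (V * V') = V * (V' * pauliOp v * star V') * star V := by
    simp only [star_mul, mul_assoc]
  rw [e, ← Matrix.mulVec_mulVec]
  rcases h' v with h1 | h1 <;> rw [h1] <;> rcases h (M' *ᵥ v) with h2 | h2 <;> simp [h2]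

theorem ActsAs.unique {n : ℕ} {V : Op n} {M M' : Matrix (Fin n ⊕ Fin n) (Fin n ⊕ Fin n) (ZMod 2)}
    (h : ActsAs V M) (h' : ActsAs V M') : M = M' := by
  refine Matrix.mulVec_injective (funext fun v => pauliOp_inj ?_)
  rcases h v with k | k <;> rcases h' v with k' | k' <;> rw [k] at k'
  · exact Or.inl k'
  · exact Or.inr k'
  · exact Or.inr (by rw [← k', neg_neg])
  · exact Or.inl (neg_injective k')

theorem sgn_injective : Function.Injective sgn := by
  intro a b
  rcases zmod2_cases a with rfl | rfl <;> rcases zmod2_cases b with rfl | rfl <;>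
    norm_num [sgn_zero, sgn_one]

/-- Conjugation preserves commutation signs, and these signs are the values of the symplectic form.
-/
theorem ActsAs.mem_symplecticGroup {n : ℕ} {V : UGroup n}
    {M : Matrix (Fin n ⊕ Fin n) (Fin n ⊕ Fin n) (ZMod 2)} (h : ActsAs (V : Op n) M) :
    M ∈ Matrix.symplecticGroup (Fin n) (ZMod 2) := by
  have hV : star (V : Op n) * (V : Op n) = 1 := Matrix.UnitaryGroup.star_mul_self V
  choose s hs hs' using fun v => show ∃ s : ℂ, s ≠ 0 ∧
      (V : Op n) * pauliOp v * star (V : Op n) = s • pauliOp (M *ᵥ v) from by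
    rcases h v with k | k
    · exact ⟨1, one_ne_zero, by rw [k, one_smul]⟩
    · exact ⟨-1, by simp, by rw [k, neg_one_smul]⟩
  have key : ∀ v w, (V : Op n) * (pauliOp v * pauliOp w) * star (V : Op n) =
      (s v * s w) • (pauliOp (M *ᵥ v) * pauliOp (M *ᵥ w)) := fun v w => by
    have : (V : Op n) * (pauliOp v * pauliOp w) * star (V : Op n) =
        ((V : Op n) * pauliOp v * star (V : Op n)) *
          ((V : Op n) * pauliOp w * star (V : Op n)) := by
      simp only [mul_assoc]
      rw [← mul_assoc (star (V : Op n)), hV, one_mul]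
    rw [this, hs', hs', Matrix.smul_mul, Matrix.mul_smul, smul_smul]
  refine mem_symplecticGroup_iff_symp.mpr fun v w => ?_
  have h1 := key v w
  rw [pauliOp_comm, Matrix.mul_smul, Matrix.smul_mul, key, pauliOp_comm (M *ᵥ v), smul_smul,
    smul_smul] at h1
  have hne : pauliOp (M *ᵥ w) * pauliOp (M *ᵥ v) ≠ 0 := fun h0 => by
    have := congrArg (fun X => pauliOp (M *ᵥ w) * X) h0
    simp only [← mul_assoc, pauliOp_sq, one_mul, mul_zero] at this
    exact pauliOp_ne_zero _ this
  have h2 := smul_left_injective ℂ hne h1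
  apply sgn_injective
  apply mul_right_cancel₀ (mul_ne_zero (hs v) (hs w))
  linear_combination -h2

theorem onQubit_mul {n : ℕ} (k : Fin n) (g g' : Matrix (Fin 2) (Fin 2) ℂ) :
    onQubit k g * onQubit k g' = onQubit k (g * g') := by
  rw [onQubit, onQubit, tensor_mul, onQubit]
  congr 1
  funext j
  split_ifs <;> simp

theorem onQubit_star {n : ℕ} (k : Fin n) (g : Matrix (Fin 2) (Fin 2) ℂ) :
    star (onQubit k g) = onQubit k (star g) := by
  rw [onQubit, tensor_star, onQubit]
  congr 1
  funext j
  split_ifs <;> simp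

theorem onQubit_one {n : ℕ} (k : Fin n) : onQubit k 1 = 1 := by
  simp [onQubit, tensor_one]

theorem pauliOp_single_inl {n : ℕ} (k : Fin n) :
    pauliOp (Pi.single (Sum.inl k) 1) = onQubit k (pauli1 1 0) := by
  rw [pauliOp, onQubit]
  congr 1
  funext j
  by_cases h : j = k
  · subst h; simp
  · simp [h, pauli1_00]

theorem pauliOp_single_inr {n : ℕ} (k : Fin n) :
    pauliOp (Pi.single (Sum.inr k) 1) = onQubit k (pauli1 0 1) := by
  rw [pauliOp, onQubit]
  congr 1
  funext j
  by_cases h : j = k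
  · subst h; simp
  · simp [h, pauli1_00]

theorem onQubit_conj {n : ℕ} {k : Fin n} {g : Matrix (Fin 2) (Fin 2) ℂ} (v w : BitVec2 n)
    (hvw : ∀ j ≠ k, w (Sum.inl j) = v (Sum.inl j) ∧ w (Sum.inr j) = v (Sum.inr j)) {s : ℂ}
    (hs : s = 1 ∨ s = -1)
    (h : g * pauli1 (v (Sum.inl k)) (v (Sum.inr k)) * star g =
      s • pauli1 (w (Sum.inl k)) (w (Sum.inr k))) :
    onQubit k g * pauliOp v * star (onQubit k g) = pauliOp w ∨
      onQubit k g * pauliOp v * star (onQubit k g) = -pauliOp w := by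
  have e : onQubit k g * pauliOp v * star (onQubit k g) = s • pauliOp w := by
    -- The global sign is written as a product over qubits so that `tensor_smul` can move it onto
    -- factor `k`.
    have hprod : s = ∏ j : Fin n, if j = k then s else 1 := by simp
    rw [onQubit_star, onQubit, onQubit, pauliOp, pauliOp, tensor_mul, tensor_mul]
    conv_rhs => rw [hprod, ← tensor_smul]
    congr 1
    funext j
    by_cases hj : j = k
    · subst hj; simp [h]
    · simp [hj, hvw j hj]
  rw [e]
  rcases hs with rfl | rfl <;> simp

/-- The Hadamard matrix. -/
noncomputable def hadamard1 : Matrix (Fin 2) (Fin 2) ℂ := (1 / Real.sqrt 2 : ℂ) • !![1, 1; 1, -1]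

/-- The phase matrix. -/
def phase1 : Matrix (Fin 2) (Fin 2) ℂ := !![1, 0; 0, Complex.I]

theorem hadamard1_star : star hadamard1 = hadamard1 := by
  rw [hadamard1, one_div, star_smul, star_inv_sqrt_two]
  congr 1
  ext i j
  fin_cases i <;> fin_cases j <;> simp [Matrix.star_apply]

/-- Merges the two factors 1/√2 so that the case checks involve no square roots. -/
theorem hadamard1_conj_eq (M : Matrix (Fin 2) (Fin 2) ℂ) :
    hadamard1 * M * hadamard1 = (1 / 2 : ℂ) • (!![1, 1; 1, -1] * M * !![1, 1; 1, -1]) := by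
  have : (Real.sqrt 2 : ℂ)⁻¹ * (Real.sqrt 2 : ℂ)⁻¹ = 1 / 2 := by
    linear_combination (1 / 2) * inv_sqrt_two_mul_self
  rw [hadamard1, one_div, Matrix.smul_mul, Matrix.mul_smul, Matrix.smul_mul, smul_smul, this]

theorem hadamard1_mul_self : hadamard1 * hadamard1 = 1 := by
  have := hadamard1_conj_eq 1
  rw [mul_one, mul_one] at this
  rw [this, Matrix.one_fin_two]
  simp
  norm_num

theorem hadamard1_conj (x z : ZMod 2) :
    ∃ s : ℂ, (s = 1 ∨ s = -1) ∧ hadamard1 * pauli1 x z * star hadamard1 = s • pauli1 z x := by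
  rw [hadamard1_star, hadamard1_conj_eq]
  rcases zmod2_cases x with rfl | rfl <;> rcases zmod2_cases z with rfl | rfl <;>
    simp only [pauli1_00, pauli1_01, pauli1_10, pauli1_11]
  · refine ⟨1, Or.inl rfl, ?_⟩
    simp [Matrix.one_fin_two]
    norm_num
  · refine ⟨1, Or.inl rfl, ?_⟩
    simp
    norm_num
  · refine ⟨1, Or.inl rfl, ?_⟩
    simp
    norm_num
  · refine ⟨-1, Or.inr rfl, ?_⟩
    simp
    constructor <;> ring

theorem phase1_star : star phase1 = !![1, 0; 0, -Complex.I] := by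
  ext i j
  fin_cases i <;> fin_cases j <;> simp [Matrix.star_apply, phase1]

theorem phase1_conj (x z : ZMod 2) :
    ∃ s : ℂ, (s = 1 ∨ s = -1) ∧ phase1 * pauli1 x z * star phase1 = s • pauli1 x (z + x) := by
  rw [phase1_star, phase1]
  rcases zmod2_cases x with rfl | rfl <;> rcases zmod2_cases z with rfl | rfl <;>
    simp only [pauli1_00, pauli1_01, pauli1_10, pauli1_11, CharTwo.add_self_eq_zero, add_zero,
      zero_add]
  · exact ⟨1, Or.inl rfl, by simp [Matrix.one_fin_two]⟩
  · exact ⟨1, Or.inl rfl, by simp⟩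
  · exact ⟨1, Or.inl rfl, by simp⟩
  · exact ⟨-1, Or.inr rfl, by simp⟩

theorem phase1_mul_self : phase1 * phase1 = pauli1 0 1 := by
  simp [phase1, pauli1_01]

/-- The two-qubit case in matrix entries: X spreads from control to target and Z from target to
control. -/
theorem cnot_pauli1 (x z x' z' : ZMod 2) : ∃ s : ℂ, (s = 1 ∨ s = -1) ∧ ∀ a b a' b' : Fin 2,
    pauli1 x z a b * pauli1 x' z' (a' + a) (b' + b) =
      s * (pauli1 x (z + z') a b * pauli1 (x' + x) z' a' b') := by
  rcases zmod2_cases x with rfl | rfl <;> rcases zmod2_cases z with rfl | rfl <;>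
    rcases zmod2_cases x' with rfl | rfl <;> rcases zmod2_cases z' with rfl | rfl <;>
    simp only [pauli1_00, pauli1_01, pauli1_10, pauli1_11, CharTwo.add_self_eq_zero, add_zero,
      zero_add, Matrix.one_fin_two] <;>
    first
    | (refine ⟨1, Or.inl rfl, ?_⟩
       simp [Fin.forall_fin_two]; done)
    | (refine ⟨-1, Or.inr rfl, ?_⟩
       simp [Fin.forall_fin_two]; done)

/-- The action of a CNOT gate on basis states. -/
def cnotFun {n : ℕ} (c t : Fin n) (a : Basis n) : Basis n := Function.update a t (a t + a c)

theorem cnotFun_involutive {n : ℕ} {c t : Fin n} (h : c ≠ t) (a : Basis n) :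
    cnotFun c t (cnotFun c t a) = a := by
  have h2 : ∀ x y : Fin 2, x + y + y = x := by decide
  ext j
  by_cases hj : j = t
  · subst hj; simp [cnotFun, h, h2]
  · simp [cnotFun, hj]

theorem eq_cnotFun_iff {n : ℕ} {c t : Fin n} (h : c ≠ t) (a b : Basis n) :
    a = cnotFun c t b ↔ b = cnotFun c t a := by
  constructor <;> (rintro rfl; rw [cnotFun_involutive h])

theorem op_cnot_apply {n : ℕ} (c t : Fin n) (h : c ≠ t) (a b : Basis n) :
    (Gate.cnot c t h).op a b = if a = cnotFun c t b then 1 else 0 := rfl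

theorem star_op_cnot {n : ℕ} (c t : Fin n) (h : c ≠ t) :
    star (Gate.cnot c t h).op = (Gate.cnot c t h).op := by
  ext a b
  rw [Matrix.star_apply, op_cnot_apply, op_cnot_apply]
  refine (congrArg star (if_congr (eq_cnotFun_iff h b a) rfl rfl)).trans ?_
  split_ifs <;> simp

theorem op_cnot_conj {n : ℕ} (c t : Fin n) (h : c ≠ t) (M : Op n) (a b : Basis n) :
    ((Gate.cnot c t h).op * M * (Gate.cnot c t h).op) a b = M (cnotFun c t a) (cnotFun c t b) := by
  simp [Matrix.mul_apply, op_cnot_apply, eq_cnotFun_iff h a]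

theorem pauliOp_cnotFun {n : ℕ} {c t : Fin n} (h : c ≠ t) (v : BitVec2 n) :
    ∃ s : ℂ, (s = 1 ∨ s = -1) ∧ ∀ a b, pauliOp v (cnotFun c t a) (cnotFun c t b) =
      s * pauliOp (v + Pi.single (Sum.inl t) (v (Sum.inl c)) +
        Pi.single (Sum.inr c) (v (Sum.inr t))) a b := by
  obtain ⟨s, hs, hs'⟩ := cnot_pauli1 (v (Sum.inl c)) (v (Sum.inr c)) (v (Sum.inl t)) (v (Sum.inr t))
  refine ⟨s, hs, fun a b => ?_⟩
  have htc : t ∈ Finset.univ.erase c := by simp [h.symm]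
  simp only [pauliOp, tensor, Matrix.of_apply]
  rw [← Finset.mul_prod_erase _ _ (Finset.mem_univ c), ← Finset.mul_prod_erase _ _ htc,
    ← Finset.mul_prod_erase _ _ (Finset.mem_univ c), ← Finset.mul_prod_erase _ _ htc, ← mul_assoc,
    ← mul_assoc, ← mul_assoc]
  congr 1
  · have := hs' (a c) (b c) (a t) (b t)
    simpa [cnotFun, h, h.symm, mul_assoc] using this
  · refine Finset.prod_congr rfl fun j hj => ?_
    have h1 : j ≠ t := Finset.ne_of_mem_erase hj
    have h2 : j ≠ c := Finset.ne_of_mem_erase (Finset.mem_of_mem_erase hj)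
    simp [cnotFun, h1, h2]

theorem Gate.actsAs {n : ℕ} (g : Gate n) : ActsAs g.op g.act := by
  intro v
  cases g with
  | h k =>
    have e : (Gate.h k).act = (Gate.h k).tab := by simp [Gate.act, Gate.dual]
    rw [e, tab_h_mulVec]
    obtain ⟨s, hs, hs'⟩ := hadamard1_conj (v (Sum.inl k)) (v (Sum.inr k))
    refine onQubit_conj v _ (fun j hj => ?_) hs
      (by change hadamard1 * _ * star hadamard1 = _; simpa using hs')
    simp [hj, Equiv.swap_apply_of_ne_of_ne]
  | p k =>
    rw [act_p_mulVec]
    obtain ⟨s, hs, hs'⟩ := phase1_conj (v (Sum.inl k)) (v (Sum.inr k))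
    refine onQubit_conj v _ (fun j hj => ?_) hs
      (by change phase1 * _ * star phase1 = _; simpa using hs')
    simp [hj]
  | cnot c t h =>
    have e : (Gate.cnot c t h).act = (Gate.cnot t c h.symm).tab := by simp [Gate.act, Gate.dual]
    rw [e, tab_cnot_mulVec, star_op_cnot]
    obtain ⟨s, hs, hs'⟩ := pauliOp_cnotFun h v
    have : (Gate.cnot c t h).op * pauliOp v * (Gate.cnot c t h).op = s • pauliOp (v +
        Pi.single (Sum.inl t) (v (Sum.inl c)) + Pi.single (Sum.inr c) (v (Sum.inr t))) := by
      ext a b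
      rw [op_cnot_conj, hs', Matrix.smul_apply, smul_eq_mul]
    rw [this]
    rcases hs with rfl | rfl <;> simp

theorem Gate.op_mem_unitaryGroup {n : ℕ} (g : Gate n) :
    g.op ∈ Matrix.unitaryGroup (Basis n) ℂ := by
  rw [Matrix.mem_unitaryGroup_iff]
  cases g with
  | h k =>
    change onQubit k hadamard1 * star (onQubit k hadamard1) = 1
    rw [onQubit_star, onQubit_mul, hadamard1_star, hadamard1_mul_self, onQubit_one]
  | p k =>
    change onQubit k phase1 * star (onQubit k phase1) = 1
    have : phase1 * star phase1 = 1 := by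
      rw [phase1_star, phase1]
      simp [Matrix.one_fin_two]
    rw [onQubit_star, onQubit_mul, this, onQubit_one]
  | cnot c t h =>
    rw [star_op_cnot]
    ext a b
    have := op_cnot_conj c t h 1 a b
    rw [mul_one] at this
    rw [this, Matrix.one_apply, Matrix.one_apply]
    refine if_congr ?_ rfl rfl
    rw [eq_cnotFun_iff h, cnotFun_involutive h, eq_comm]

theorem circuit_actsAs {n : ℕ} (c : List (Gate n)) :
    ActsAs (c.map Gate.op).prod (c.map Gate.act).prod := by
  induction c with
  | nil => intro v; simp
  | cons g c ih =>
    rw [List.map_cons, List.map_cons, List.prod_cons, List.prod_cons]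
    exact g.actsAs.mul ih

theorem exists_circuit_clifford {n : ℕ} (c : List (Gate n)) :
    ∃ V : cliffordUnitary n, ((V : UGroup n) : Op n) = (c.map Gate.op).prod ∧
      (tableau (QuotientGroup.mk V : Clifford n)).1 = (c.map Gate.act).prod := by
  have hu : (c.map Gate.op).prod ∈ Matrix.unitaryGroup (Basis n) ℂ :=
    Submonoid.list_prod_mem _ fun x hx => by
      obtain ⟨g, _, rfl⟩ := List.mem_map.mp hx
      exact g.op_mem_unitaryGroup
  obtain ⟨V, hV⟩ : ∃ V : UGroup n, (V : Op n) = (c.map Gate.op).prod := ⟨⟨_, hu⟩, rfl⟩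
  have ha : ActsAs (V : Op n) (c.map Gate.act).prod := hV ▸ circuit_actsAs c
  obtain ⟨U, hU⟩ : ∃ U : Sp n, U.1 = (c.map Gate.act).prod := ⟨⟨_, ha.mem_symplecticGroup⟩, rfl⟩
  have hI : Implements V U := fun v => by
    rw [hU]
    exact ha v
  refine ⟨⟨V, U, hI⟩, hV, ?_⟩
  rw [tableau_mk ⟨V, U, hI⟩ hI, hU]

/-! ## Pauli operators cost nothing -/

/-- Up to phase, Pauli operators are products of single-qubit Z = PP and X = HPPH. -/
theorem exists_circuit_pauliOp {n : ℕ} (w : BitVec2 n) :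
    ∃ c : List (Gate n), cnotCount c = 0 ∧ ∃ φ : ℂ, (c.map Gate.op).prod = φ • pauliOp w := by
  have hw : w = ∑ i, Pi.single i (w i) := (Finset.univ_sum_single w).symm
  rw [hw]
  refine Finset.sum_induction _ (fun w => ∃ c : List (Gate n), cnotCount c = 0 ∧
    ∃ φ : ℂ, (c.map Gate.op).prod = φ • pauliOp w) ?_ ?_ ?_
  · rintro v w ⟨c, hc, φ, hφ⟩ ⟨d, hd, ψ, hψ⟩
    obtain ⟨χ, _, hχ⟩ := pauliOp_mul v w
    refine ⟨c ++ d, by rw [cnotCount_append, hc, hd], φ * ψ * χ, ?_⟩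
    rw [List.map_append, List.prod_append, hφ, hψ, Matrix.smul_mul, Matrix.mul_smul, hχ, smul_smul,
      smul_smul, mul_assoc]
  · exact ⟨[], rfl, 1, by simp [pauliOp_zero]⟩
  · intro i _
    rcases zmod2_cases (w i) with h | h
    · exact ⟨[], rfl, 1, by simp [h, pauliOp_zero]⟩
    · rw [h]
      have hp : ∀ k : Fin n, (Gate.p k).op * (Gate.p k).op = onQubit k (pauli1 0 1) := fun k => by
        rw [← phase1_mul_self, ← onQubit_mul]
        rfl
      rcases i with k | k
      · refine ⟨[.h k, .p k, .p k, .h k], rfl, 1, ?_⟩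
        have hX : hadamard1 * pauli1 0 1 * hadamard1 = pauli1 1 0 := by
          rw [hadamard1_conj_eq, pauli1_01, pauli1_10]
          simp
          norm_num
        have hh : (Gate.h k).op = onQubit k hadamard1 := rfl
        simp only [List.map_cons, List.map_nil, List.prod_cons, List.prod_nil, mul_one]
        rw [← mul_assoc (Gate.p k).op, hp, hh, onQubit_mul, onQubit_mul, ← mul_assoc, hX,
          pauliOp_single_inl, one_smul]
      · refine ⟨[.p k, .p k], rfl, 1, ?_⟩
        simp only [List.map_cons, List.map_nil, List.prod_cons, List.prod_nil, mul_one]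
        rw [hp, pauliOp_single_inr, one_smul]

/-- The dualized circuit has the tableau of `q`, so it differs from `q` by a Pauli operator, which
is appended at no cost. -/
theorem exists_circuit_of_tableau {n : ℕ} (q : Clifford n) (c : List (Gate n))
    (h : (tableau q).1 = (c.map Gate.tab).prod) :
    ∃ (d : List (Gate n)) (V : cliffordUnitary n), (QuotientGroup.mk V : Clifford n) = q ∧
      ((V : UGroup n) : Op n) = (d.map Gate.op).prod ∧ cnotCount d = cnotCount c := by
  obtain ⟨V, hV, hVt⟩ := exists_circuit_clifford (c.flatMap Gate.dual)
  have ht : tableau q = tableau (QuotientGroup.mk V : Clifford n) := by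
    apply Subtype.ext
    rw [hVt, h, prod_map_flatMap]
    simp only [prod_act_dual]
  obtain ⟨w, rfl⟩ := tableau_eq_iff.mp ht
  obtain ⟨d, hd, φ, hφ⟩ := exists_circuit_pauliOp w
  obtain ⟨D, hD, -⟩ := exists_circuit_clifford d
  refine ⟨c.flatMap Gate.dual ++ d, V * D, ?_, ?_, ?_⟩
  · rw [QuotientGroup.mk_mul]
    congr 1
    unfold pauli
    rw [QuotientGroup.eq]
    refine ⟨star φ, ?_⟩
    change star ((D : UGroup n) : Op n) * pauliOp w = _
    rw [hD, hφ, star_smul, pauliOp_star, Matrix.smul_mul, pauliOp_sq]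
  · rw [List.map_append, List.prod_append, ← hV, ← hD]
    rfl
  · rw [cnotCount_append, hd, cnotCount_flatMap_dual, add_zero]

/-- The two sets of attainable CNOT counts coincide, hence so do their infima, whether or not a
circuit exists. -/
theorem cost_eq_costSp {n : ℕ} (q : Clifford n) : cost q = costSp (tableau q) := by
  rw [cost, costSp]
  congr 1
  ext m
  constructor
  · rintro ⟨c, V, rfl, hV, rfl⟩
    refine ⟨c.flatMap Gate.dual, ?_, cnotCount_flatMap_dual c⟩
    obtain ⟨V', hV', hVt⟩ := exists_circuit_clifford c
    have : V = V' := Subtype.ext (Subtype.ext (hV.trans hV'.symm))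
    rw [this, hVt, prod_map_flatMap]
    rfl
  · rintro ⟨c, hc, rfl⟩
    exact exists_circuit_of_tableau q c hc

theorem avgCost_eq {n : ℕ} (μ : Clifford n → ℝ) : avgCost μ = avgCostSp (induced μ) := by
  rw [avgCost, avgCostSp, sum_induced_mul]
  simp only [cost_eq_costSp]

/-! ## The local subgroup and qubit permutations -/

theorem exists_localGroup_h {n : ℕ} (k : Fin n) : ∃ K ∈ localGroup n, K.1 = (Gate.h k).tab :=
  ⟨_, Subgroup.subset_closure ⟨k, Or.inl (transvection_eq_tab_h k)⟩, transvection_eq_tab_h k⟩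

theorem exists_localGroup_p {n : ℕ} (k : Fin n) : ∃ K ∈ localGroup n, K.1 = (Gate.p k).tab :=
  ⟨_, Subgroup.subset_closure ⟨k, Or.inr (transvection_eq_tab_p k)⟩, transvection_eq_tab_p k⟩

/-- A local symplectic matrix maps a given vector to one whose first half vanishes. -/
theorem exists_localGroup_mulVec_inl_eq_zero {n : ℕ} (x : BitVec2 n) :
    ∃ K ∈ localGroup n, ∀ j, (K.1 *ᵥ x) (Sum.inl j) = 0 := by
  suffices H : ∀ S : Finset (Fin n), ∃ K ∈ localGroup n, ∀ j ∈ S, (K.1 *ᵥ x) (Sum.inl j) = 0 by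
    obtain ⟨K, hK, h⟩ := H Finset.univ
    exact ⟨K, hK, fun j => h j (Finset.mem_univ j)⟩
  intro S
  induction S using Finset.induction_on with
  | empty => exact ⟨1, Subgroup.one_mem _, by simp⟩
  | insert k S hk ih =>
    obtain ⟨K, hK, h⟩ := ih
    have hne : ∀ j ∈ S, j ≠ k := fun j hj e => hk (e ▸ hj)
    rcases zmod2_cases ((K.1 *ᵥ x) (Sum.inl k)) with h0 | h0
    · refine ⟨K, hK, fun j hj => ?_⟩
      rcases Finset.mem_insert.mp hj with rfl | hj
      exacts [h0, h j hj]
    -- The block on qubit `k` is now 10 or 11; H turns the former into 01 and P the latter.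
    · rcases zmod2_cases ((K.1 *ᵥ x) (Sum.inr k)) with h1 | h1
      · obtain ⟨A, hA, hAt⟩ := exists_localGroup_h k
        refine ⟨A * K, Subgroup.mul_mem _ hA hK, fun j hj => ?_⟩
        rw [Sp.mul_mulVec, hAt, tab_h_mulVec]
        rcases Finset.mem_insert.mp hj with rfl | hj
        · simpa using h1
        · simpa [Equiv.swap_apply_of_ne_of_ne, hne j hj] using h j hj
      · obtain ⟨A, hA, hAt⟩ := exists_localGroup_p k
        refine ⟨A * K, Subgroup.mul_mem _ hA hK, fun j hj => ?_⟩
        rw [Sp.mul_mulVec, hAt, tab_p_mulVec]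
        rcases Finset.mem_insert.mp hj with rfl | hj
        · simp [h0, h1, CharTwo.add_self_eq_zero]
        · simpa [hne j hj] using h j hj

theorem exists_circuit_localGroup {n : ℕ} {K : Sp n} (hK : K ∈ localGroup n) :
    ∃ c : List (Gate n), K.1 = (c.map Gate.tab).prod ∧ cnotCount c = 0 := by
  have hmul : ∀ K L : Sp n, (∃ c : List (Gate n), K.1 = (c.map Gate.tab).prod ∧ cnotCount c = 0) →
      (∃ c : List (Gate n), L.1 = (c.map Gate.tab).prod ∧ cnotCount c = 0) →
      ∃ c : List (Gate n), (K * L).1 = (c.map Gate.tab).prod ∧ cnotCount c = 0 := by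
    rintro K L ⟨c, hc, hc0⟩ ⟨d, hd, hd0⟩
    exact ⟨c ++ d, by rw [Submonoid.coe_mul, hc, hd, List.map_append, List.prod_append],
      by rw [cnotCount_append, hc0, hd0]⟩
  have hone : ∃ c : List (Gate n), (1 : Sp n).1 = (c.map Gate.tab).prod ∧ cnotCount c = 0 :=
    ⟨[], rfl, rfl⟩
  induction hK using Subgroup.closure_induction with
  | mem U hU =>
    obtain ⟨k, hk | hk⟩ := hU
    · exact ⟨[.h k], by simp [hk], rfl⟩
    · exact ⟨[.p k], by simp [hk], rfl⟩
  | one => exact hone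
  | mul K L _ _ hK hL => exact hmul K L hK hL
  | inv K _ hK =>
    have hpow : ∀ m : ℕ, ∃ c : List (Gate n), (K ^ m).1 = (c.map Gate.tab).prod ∧
        cnotCount c = 0 := fun m => by
      induction m with
      | zero => exact hone
      | succ m ih =>
        rw [pow_succ]
        exact hmul _ _ ih hK
    -- The group is finite, so inverses are powers and no inverse gates are needed.
    have hinv : K⁻¹ = K ^ (orderOf K - 1) := by
      rw [inv_eq_iff_mul_eq_one, ← pow_succ', Nat.sub_add_cancel (orderOf_pos K),
        pow_orderOf_eq_one]
    rw [hinv]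
    exact hpow _

/-- Relabelling of the qubits of a gate. -/
def Gate.relabel {n : ℕ} (σ : Equiv.Perm (Fin n)) : Gate n → Gate n
  | .h k => .h (σ k)
  | .p k => .p (σ k)
  | .cnot c t hct => .cnot (σ c) (σ t) (σ.injective.ne hct)

theorem tab_mulVec_comp {n : ℕ} (σ : Equiv.Perm (Fin n)) (g : Gate n) (v : BitVec2 n) :
    g.tab *ᵥ (v ∘ Equiv.Perm.sumCongr σ σ) =
      ((g.relabel σ).tab *ᵥ v) ∘ Equiv.Perm.sumCongr σ σ := by
  cases g with
  | h k =>
    rw [Gate.relabel, tab_h_mulVec, tab_h_mulVec]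
    ext (j | j) <;> by_cases hj : j = k
    · subst hj; simp
    · simp [hj, Equiv.swap_apply_of_ne_of_ne]
    · subst hj; simp
    · simp [hj, Equiv.swap_apply_of_ne_of_ne]
  | p k =>
    rw [Gate.relabel, tab_p_mulVec, tab_p_mulVec]
    ext (j | j) <;> simp [Pi.single_apply]
  | cnot c t h =>
    rw [Gate.relabel, tab_cnot_mulVec, tab_cnot_mulVec]
    ext (j | j) <;> simp [Pi.single_apply]

/-- Conjugating by a qubit permutation relabels the gates, which keeps the CNOT count. -/
theorem prod_tab_mul_permMatrix {n : ℕ} (σ : Equiv.Perm (Fin n)) (c : List (Gate n)) :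
    (c.map Gate.tab).prod * Equiv.Perm.permMatrix (ZMod 2) (Equiv.Perm.sumCongr σ σ) =
      Equiv.Perm.permMatrix (ZMod 2) (Equiv.Perm.sumCongr σ σ) *
        ((c.map (Gate.relabel σ)).map Gate.tab).prod := by
  induction c with
  | nil => simp
  | cons g c ih =>
    have hg : g.tab * Equiv.Perm.permMatrix (ZMod 2) (Equiv.Perm.sumCongr σ σ) =
        Equiv.Perm.permMatrix (ZMod 2) (Equiv.Perm.sumCongr σ σ) * (g.relabel σ).tab := by
      refine Matrix.mulVec_injective (funext fun v => ?_)
      rw [← Matrix.mulVec_mulVec, ← Matrix.mulVec_mulVec, Matrix.permMatrix_mulVec,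
        Matrix.permMatrix_mulVec, tab_mulVec_comp]
    simp only [List.map_cons, List.prod_cons]
    rw [mul_assoc, ih, ← mul_assoc, hg, mul_assoc]

theorem cnotCount_relabel {n : ℕ} (σ : Equiv.Perm (Fin n)) (c : List (Gate n)) :
    cnotCount (c.map (Gate.relabel σ)) = cnotCount c := by
  rw [cnotCount, cnotCount, List.map_map]
  congr 2
  funext g
  cases g <;> rfl

/-- W⁻¹ U W has the relabelled circuit, and the local factors are free. -/
theorem exists_circuit_of_mem_cls {n : ℕ} {U V : Sp n} (h : V ∈ cls U) {c : List (Gate n)}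
    (hc : U.1 = (c.map Gate.tab).prod) :
    ∃ d : List (Gate n), V.1 = (d.map Gate.tab).prod ∧ cnotCount d = cnotCount c := by
  obtain ⟨K, hK, L, hL, W, ⟨σ, hσ⟩, rfl⟩ := h
  obtain ⟨k, hk, hk0⟩ := exists_circuit_localGroup hK
  obtain ⟨l, hl, hl0⟩ := exists_circuit_localGroup hL
  refine ⟨k ++ c.map (Gate.relabel σ) ++ l, ?_, ?_⟩
  · have hW : U.1 * W.1 = W.1 * ((c.map (Gate.relabel σ)).map Gate.tab).prod := by
      rw [hc, hσ, prod_tab_mul_permMatrix]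
    have hW' : (W⁻¹).1 * W.1 = 1 := by
      rw [← Submonoid.coe_mul, inv_mul_cancel]
      rfl
    rw [List.map_append, List.map_append, List.prod_append, List.prod_append, ← hk, ← hl]
    change K.1 * (W⁻¹).1 * U.1 * W.1 * L.1 = _
    rw [mul_assoc (K.1 * _), hW, mul_assoc K.1, ← mul_assoc (W⁻¹).1, hW', one_mul]
  · rw [cnotCount_append, cnotCount_append, hk0, hl0, cnotCount_relabel, zero_add, add_zero]

theorem mul_mul_mem_cls {n : ℕ} (U : Sp n) {K L : Sp n} (hK : K ∈ localGroup n)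
    (hL : L ∈ localGroup n) : K * U * L ∈ cls U :=
  ⟨K, hK, L, hL, 1, ⟨1, by simp⟩, by simp⟩

/-! ## Classes and their representatives -/

namespace IsReduction

variable {n : ℕ} {f : Sp n → Sp n}

/-- Classes are the fibres of `f`, so symmetry and transitivity are read off from `f` instead of
being computed with K, L and W. -/
theorem mem_cls_comm (hf : IsReduction f) {U V : Sp n} : V ∈ cls U ↔ U ∈ cls V := by
  rw [← hf.2, ← hf.2, eq_comm]

theorem cls_eq (hf : IsReduction f) {U V : Sp n} (h : V ∈ cls U) : cls V = cls U := by
  ext W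
  rw [← hf.2, ← hf.2, (hf.2 U V).mpr h]

theorem mem_cls_self (hf : IsReduction f) (U : Sp n) : U ∈ cls U := (hf.2 U U).mp rfl

theorem apply_apply (hf : IsReduction f) (U : Sp n) : f (f U) = f U :=
  ((hf.2 U (f U)).mpr (hf.1 U)).symm

theorem mem_cls_iff (hf : IsReduction f) (r : Reduced f) (U : Sp n) :
    U ∈ cls r.1 ↔ (⟨f U, U, rfl⟩ : Reduced f) = r := by
  obtain ⟨_, V, rfl⟩ := r
  rw [← hf.2, hf.apply_apply]
  exact ⟨fun h => Subtype.ext h.symm, fun h => (congrArg Subtype.val h).symm⟩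

theorem costSp_eq (hf : IsReduction f) {U V : Sp n} (h : V ∈ cls U) : costSp V = costSp U := by
  rw [costSp, costSp]
  congr 1
  ext m
  constructor
  · rintro ⟨c, hc, rfl⟩
    exact exists_circuit_of_mem_cls (hf.mem_cls_comm.mp h) hc
  · rintro ⟨c, hc, rfl⟩
    exact exists_circuit_of_mem_cls h hc

theorem transProb_eq (hf : IsReduction f) {U V : Sp n} (h : V ∈ cls U) (x y : BitVec2 n) :
    transProb V x y = transProb U x y := by
  rw [transProb, transProb, hf.cls_eq h]

open Classical in
theorem sum_reduced (hf : IsReduction f) (F : Sp n → ℝ) :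
    ∑ r : Reduced f, ∑ U with U ∈ cls r.1, F U = ∑ U, F U := by
  rw [← Finset.sum_fiberwise Finset.univ (fun U => (⟨f U, U, rfl⟩ : Reduced f)) F]
  refine Finset.sum_congr rfl fun r _ => Finset.sum_congr ?_ fun _ _ => rfl
  ext U
  simp [hf.mem_cls_iff]

theorem sum_reducedDist_mul (hf : IsReduction f) (π F : Sp n → ℝ)
    (hF : ∀ U V, V ∈ cls U → F V = F U) :
    ∑ r : Reduced f, reducedDist f π r * F r.1 = ∑ U, π U * F U := by
  classical
  rw [← hf.sum_reduced]
  refine Finset.sum_congr rfl fun r _ => ?_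
  rw [reducedDist, Finset.sum_mul]
  refine Finset.sum_congr (by ext; simp) fun U hU => ?_
  rw [hF r.1 U (Finset.mem_filter.mp hU).2]

end IsReduction

open Classical in
theorem ncard_eq_card_filter {α : Type*} [Fintype α] (S : Set α) :
    S.ncard = (Finset.univ.filter fun a => a ∈ S).card := by
  rw [← Set.ncard_coe_finset]
  congr 1
  ext
  simp

open Classical in
theorem transProb_eq_sum {n : ℕ} (U : Sp n) (x y : BitVec2 n) :
    transProb U x y = (∑ V with V ∈ cls U, if V.1 *ᵥ x = y then (1 : ℝ) else 0) / (cls U).ncard := by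
  rw [transProb, ncard_eq_card_filter {U' | U' ∈ cls U ∧ U'.1 *ᵥ x = y}, Finset.sum_boole,
    Finset.filter_filter]
  simp only [Set.mem_ofPred_eq]

namespace IsReduction

variable {n : ℕ} {f : Sp n → Sp n}

theorem ncard_cls_ne_zero (hf : IsReduction f) (U : Sp n) : ((cls U).ncard : ℝ) ≠ 0 :=
  Nat.cast_ne_zero.mpr (Set.ncard_ne_zero_of_mem (hf.mem_cls_self U))

theorem symLift_eq (hf : IsReduction f) (η : Reduced f → ℝ) {U V : Sp n} (h : V ∈ cls U) :
    symLift f η V = symLift f η U := by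
  have : (⟨f V, V, rfl⟩ : Reduced f) = ⟨f U, U, rfl⟩ := Subtype.ext ((hf.2 U V).mpr h).symm
  rw [symLift, symLift, hf.cls_eq h, this]

theorem symLift_apply (hf : IsReduction f) (η : Reduced f → ℝ) {r : Reduced f} {U : Sp n}
    (h : U ∈ cls r.1) : symLift f η U = η r / (cls r.1).ncard := by
  rw [symLift, hf.cls_eq h, (hf.mem_cls_iff r U).mp h]

theorem symLift_reducedDist (hf : IsReduction f) {π : Sp n → ℝ}
    (hπ : ∀ U V : Sp n, V ∈ cls U → π V = π U) : symLift f (reducedDist f π) = π := by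
  classical
  funext U
  rw [symLift, reducedDist, div_eq_iff (hf.ncard_cls_ne_zero U)]
  have h : cls (f U) = cls U := hf.cls_eq (hf.1 U)
  simp only [h]
  rw [Finset.sum_congr rfl fun V hV => hπ U V (Finset.mem_filter.mp hV).2, Finset.sum_const,
    nsmul_eq_mul, ncard_eq_card_filter, mul_comm]

theorem reducedDist_symLift (hf : IsReduction f) (η : Reduced f → ℝ) :
    reducedDist f (symLift f η) = η := by
  classical
  funext r
  rw [reducedDist,
    Finset.sum_congr rfl fun U hU => hf.symLift_apply η (Finset.mem_filter.mp hU).2,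
    Finset.sum_const, nsmul_eq_mul, ← ncard_eq_card_filter,
    mul_div_cancel₀ _ (hf.ncard_cls_ne_zero r.1)]

open Classical in
theorem sum_mul_transProb (hf : IsReduction f) (η : Reduced f → ℝ) (x y : BitVec2 n) :
    ∑ r, η r * transProb r.1 x y = ∑ U : Sp n with U.1 *ᵥ x = y, symLift f η U := by
  rw [Finset.sum_filter, ← hf.sum_reduced]
  refine Finset.sum_congr rfl fun r _ => ?_
  rw [transProb_eq_sum, mul_div_assoc', Finset.mul_sum, Finset.sum_div]
  refine Finset.sum_congr rfl fun U hU => ?_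
  rw [hf.symLift_apply η (Finset.mem_filter.mp hU).2]
  split_ifs <;> simp

theorem sum_symLift (hf : IsReduction f) (η : Reduced f → ℝ) : ∑ U, symLift f η U = ∑ r, η r := by
  have := hf.sum_reducedDist_mul (symLift f η) (fun _ => 1) fun _ _ _ => rfl
  simpa [hf.reducedDist_symLift] using this.symm

/-! ## Averaging over classes -/

/-- The pairs `(A, C)` for which `U ↦ A U C` preserves classes. -/
def symmetryGroup (f : Sp n → Sp n) : Subgroup (Sp n × (Sp n)ᵐᵒᵖ) where
  carrier := {γ | ∀ U, f (γ.1 * U * γ.2.unop) = f U}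
  one_mem' := fun U => by simp
  mul_mem' := by
    intro γ δ hγ hδ U
    have : (γ * δ).1 * U * (γ * δ).2.unop = γ.1 * (δ.1 * U * δ.2.unop) * γ.2.unop := by
      simp [mul_assoc]
    rw [this, hγ, hδ]
  inv_mem' := by
    intro γ hγ U
    rw [← hγ ((γ⁻¹).1 * U * (γ⁻¹).2.unop)]
    simp [mul_assoc]

/-- The action of the symmetry group. -/
def symmetryAct (γ : Sp n × (Sp n)ᵐᵒᵖ) (U : Sp n) : Sp n := γ.1 * U * γ.2.unop

theorem symmetryAct_mul (γ δ : Sp n × (Sp n)ᵐᵒᵖ) (U : Sp n) :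
    symmetryAct (γ * δ) U = symmetryAct γ (symmetryAct δ U) := by
  simp [symmetryAct, mul_assoc]

theorem symmetryAct_one (U : Sp n) : symmetryAct 1 U = U := by simp [symmetryAct]

/-- The pair (K W⁻¹, W L) moves every matrix within its class, so it lies in `symmetryGroup f`; the
orbits of this group are therefore exactly the classes. -/
theorem exists_symmetryAct_eq (hf : IsReduction f) {U V : Sp n} (h : V ∈ cls U) :
    ∃ γ : symmetryGroup f, symmetryAct γ.1 U = V := by
  obtain ⟨K, hK, L, hL, W, hW, rfl⟩ := h
  refine ⟨⟨(K * W⁻¹, MulOpposite.op (W * L)), fun X => ?_⟩, ?_⟩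
  · exact ((hf.2 X _).mpr ⟨K, hK, L, hL, W, hW, by simp [mul_assoc]⟩).symm
  · simp [symmetryAct, mul_assoc]

theorem symmetryAct_mem_cls_iff (hf : IsReduction f) (γ : symmetryGroup f) (U V : Sp n) :
    symmetryAct γ.1 V ∈ cls U ↔ V ∈ cls U := by
  rw [← hf.2, ← hf.2, symmetryAct, γ.2 V]

/-- The average over a class is an average over the symmetry group. -/
theorem card_mul_sum_cls (hf : IsReduction f) [Fintype (symmetryGroup f)] (φ : Sp n → ℝ)
    (U : Sp n) [DecidablePred (· ∈ cls U)] :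
    (Fintype.card (symmetryGroup f) : ℝ) * ∑ V with V ∈ cls U, φ V =
      (cls U).ncard * ∑ γ : symmetryGroup f, φ (symmetryAct γ.1 U) := by
  -- Double counting of φ(γV): for fixed γ, the class is permuted (`h1`); for fixed V, translation
  -- in the group replaces V by U (`h2`).
  have h1 : ∀ γ : symmetryGroup f,
      ∑ V with V ∈ cls U, φ (symmetryAct γ.1 V) = ∑ V with V ∈ cls U, φ V := fun γ =>
    Finset.sum_bij' (fun V _ => symmetryAct γ.1 V) (fun V _ => symmetryAct (γ⁻¹).1 V)
      (fun V hV => by simpa [hf.symmetryAct_mem_cls_iff] using hV)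
      (fun V hV => by
        have := hf.symmetryAct_mem_cls_iff γ⁻¹ U V
        simpa using this.mpr (by simpa using hV))
      (fun V _ => by rw [← symmetryAct_mul]; simp [symmetryAct_one])
      (fun V _ => by rw [← symmetryAct_mul]; simp [symmetryAct_one])
      (fun V _ => rfl)
  have h2 : ∀ V ∈ Finset.univ.filter (· ∈ cls U), ∑ γ : symmetryGroup f, φ (symmetryAct γ.1 V) =
      ∑ γ : symmetryGroup f, φ (symmetryAct γ.1 U) := by
    intro V hV
    obtain ⟨δ, rfl⟩ := hf.exists_symmetryAct_eq (Finset.mem_filter.mp hV).2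
    rw [← Equiv.sum_comp (Equiv.mulRight δ) fun γ => φ (symmetryAct γ.1 U)]
    simp [symmetryAct_mul]
  calc (Fintype.card (symmetryGroup f) : ℝ) * ∑ V with V ∈ cls U, φ V
      = ∑ γ : symmetryGroup f, ∑ V with V ∈ cls U, φ (symmetryAct γ.1 V) := by simp [h1]
    _ = ∑ V with V ∈ cls U, ∑ γ : symmetryGroup f, φ (symmetryAct γ.1 V) := Finset.sum_comm
    _ = _ := by
      rw [Finset.sum_congr rfl h2, Finset.sum_const, nsmul_eq_mul, ncard_eq_card_filter]
      congr! 4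

/-- `transProb` is an average over the symmetry group of indicators of A U C x = y. For each pair
(A, C) this event is U (C x) = A⁻¹ y, and mixing gives it the same probability. Thus π need not be
class-invariant, which covers arbitrary 2-designs. -/
theorem sum_reducedDist_mul_transProb (hf : IsReduction f) {π : Sp n → ℝ} (hπ : PauliMixing π)
    {x y : BitVec2 n} (hx : x ≠ 0) (hy : y ≠ 0) :
    ∑ r, reducedDist f π r * transProb r.1 x y = 1 / (4 ^ n - 1) := by
  classical
  rw [hf.sum_reducedDist_mul π (fun U => transProb U x y) fun U V h => hf.transProb_eq h x y]
  have : Finite (Sp n)ᵐᵒᵖ := Finite.of_equiv _ MulOpposite.opEquiv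
  have : Fintype (symmetryGroup f) := Fintype.ofFinite _
  have hcard : (Fintype.card (symmetryGroup f) : ℝ) ≠ 0 := Nat.cast_ne_zero.mpr Fintype.card_ne_zero
  have ht : ∀ U, transProb U x y = (∑ γ : symmetryGroup f,
      if (symmetryAct γ.1 U).1 *ᵥ x = y then (1 : ℝ) else 0) / Fintype.card (symmetryGroup f) := by
    intro U
    rw [transProb_eq_sum, div_eq_div_iff (hf.ncard_cls_ne_zero U) hcard, mul_comm,
      hf.card_mul_sum_cls, mul_comm]
  simp only [ht, mul_div_assoc', Finset.mul_sum]
  rw [← Finset.sum_div, Finset.sum_comm, div_eq_iff hcard]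
  have hγ : ∀ γ : symmetryGroup f,
      ∑ U, π U * (if (symmetryAct γ.1 U).1 *ᵥ x = y then (1 : ℝ) else 0) = 1 / (4 ^ n - 1) := by
    intro γ
    rw [← hπ ((γ.1.2.unop).1 *ᵥ x) ((γ.1.1⁻¹).1 *ᵥ y) (Sp.mulVec_ne_zero _ hx)
      (Sp.mulVec_ne_zero _ hy), Finset.sum_filter]
    refine Finset.sum_congr rfl fun U _ => ?_
    rw [mul_ite, mul_one, mul_zero]
    refine if_congr ?_ rfl rfl
    rw [symmetryAct, Sp.mul_mulVec, Sp.mul_mulVec, Sp.mulVec_eq_iff γ.1.1]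
  simp only [hγ]
  rw [Finset.sum_const, Finset.card_univ, nsmul_eq_mul, mul_comm]

end IsReduction

open Classical in
/-- For class-invariant distributions it suffices to check Pauli mixing on `Z`-type vectors. -/
theorem pauliMixing_of_cls_invariant {n : ℕ} {π : Sp n → ℝ}
    (hπ : ∀ U V : Sp n, V ∈ cls U → π V = π U)
    (h : ∀ z w : NZ n, ∑ U : Sp n with U.1 *ᵥ (Sum.elim 0 z.1 : BitVec2 n) = (Sum.elim 0 w.1 : BitVec2 n), π U =
      1 / (4 ^ n - 1)) : PauliMixing π := by
  intro x y hx hy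
  obtain ⟨K, hK, hKx⟩ := exists_localGroup_mulVec_inl_eq_zero x
  obtain ⟨L, hL, hLy⟩ := exists_localGroup_mulVec_inl_eq_zero y
  have key : ∀ v : BitVec2 n, v ≠ 0 → (∀ j, v (Sum.inl j) = 0) →
      ∃ z : NZ n, v = (Sum.elim 0 z.1 : BitVec2 n) := fun v hv h0 => by
    have e : v = Sum.elim (0 : Fin n → ZMod 2) fun j => v (Sum.inr j) := by ext (j | j) <;> simp [h0]
    refine ⟨⟨fun j => v (Sum.inr j), fun hz => hv ?_⟩, e⟩
    rw [e, hz]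
    ext (j | j) <;> rfl
  obtain ⟨z, hz⟩ := key _ (Sp.mulVec_ne_zero K hx) hKx
  obtain ⟨w, hw⟩ := key _ (Sp.mulVec_ne_zero L hy) hLy
  -- The substitution U ↦ L⁻¹ U K stays in the class, so π is unchanged, and it turns the condition
  -- for (K x, L y) into the one for (x, y).
  rw [← h z w, Finset.sum_filter, Finset.sum_filter,
    ← Equiv.sum_comp ((Equiv.mulLeft L⁻¹).trans (Equiv.mulRight K))]
  refine Finset.sum_congr rfl fun U _ => ?_
  simp only [Equiv.trans_apply, Equiv.coe_mulLeft, Equiv.coe_mulRight]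
  rw [hπ U _ (mul_mul_mem_cls U (Subgroup.inv_mem _ hL) hK)]
  refine if_congr ?_ rfl rfl
  rw [← hz, ← hw, Sp.mul_mulVec, Sp.mul_mulVec, Sp.mulVec_eq_iff, inv_inv]

/-- The uniform distribution is Pauli mixing. -/
theorem pauliMixing_uniform (n : ℕ) : PauliMixing fun _ : Sp n => 1 / (Fintype.card (Sp n) : ℝ) := by
  classical
  intro x y hx hy
  -- Left translation by a matrix taking y to y' shows that all 4^n - 1 nonzero targets are equally
  -- likely; their probabilities add up to 1.
  have hN : ∀ y' ∈ Finset.univ.erase (0 : BitVec2 n),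
      ∑ U : Sp n with U.1 *ᵥ x = y', 1 / (Fintype.card (Sp n) : ℝ) =
        ∑ U : Sp n with U.1 *ᵥ x = y, 1 / (Fintype.card (Sp n) : ℝ) := by
    intro y' hy'
    obtain ⟨g, hg⟩ := Sp.exists_mulVec_eq hy (Finset.ne_of_mem_erase hy')
    rw [Finset.sum_filter, Finset.sum_filter, ← Equiv.sum_comp (Equiv.mulLeft g)]
    refine Finset.sum_congr rfl fun U _ => if_congr ?_ rfl rfl
    rw [Equiv.coe_mulLeft, Sp.mul_mulVec, Sp.mulVec_eq_iff, ← hg, Sp.inv_mulVec]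
  have htot : ∑ y' ∈ Finset.univ.erase (0 : BitVec2 n),
      ∑ U : Sp n with U.1 *ᵥ x = y', 1 / (Fintype.card (Sp n) : ℝ) = 1 := by
    rw [Finset.sum_fiberwise_of_maps_to fun U _ =>
      Finset.mem_erase.mpr ⟨Sp.mulVec_ne_zero U hx, Finset.mem_univ _⟩]
    simp
  rw [Finset.sum_congr rfl hN, Finset.sum_const, Finset.card_erase_of_mem (Finset.mem_univ _),
    Finset.card_univ, card_bitVec2, nsmul_eq_mul, Nat.cast_sub (Nat.one_le_pow _ _ (by norm_num))]
    at htot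
  push_cast at htot
  exact eq_one_div_of_mul_eq_one_right htot

/-! ## The linear program -/

theorem feasible_designLP_iff {n : ℕ} {f : Sp n → Sp n} (η : Reduced f → ℝ) :
    (designLP f).Feasible η ↔ (∀ r, 0 ≤ η r) ∧ ∑ r, η r = 1 ∧
      ∀ z w : NZ n, ∑ r, η r * transProb r.1 (Sum.elim 0 z.1) (Sum.elim 0 w.1) =
        1 / (4 ^ n - 1) := by
  refine and_congr_right fun _ => ?_
  rw [funext_iff, Option.forall, Prod.forall]
  simp only [designLP, Matrix.mulVec, dotProduct, one_mul, mul_comm (η _)]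

theorem value_designLP {n : ℕ} {f : Sp n → Sp n} (η : Reduced f → ℝ) :
    (designLP f).value η = ∑ r, η r * costSp r.1 := by
  simp only [LinearProgram.value, designLP, dotProduct, mul_comm]

namespace IsReduction

variable {n : ℕ} {f : Sp n → Sp n}

theorem value_reducedDist (hf : IsReduction f) (π : Sp n → ℝ) :
    (designLP f).value (reducedDist f π) = avgCostSp π := by
  rw [value_designLP, hf.sum_reducedDist_mul π (fun U => (costSp U : ℝ)) fun U V h => by
    rw [hf.costSp_eq h], avgCostSp]

theorem isProb_symLift (hf : IsReduction f) {η : Reduced f → ℝ} (h : ∀ r, 0 ≤ η r)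
    (h1 : ∑ r, η r = 1) : IsProb (symLift f η) :=
  ⟨fun _ => div_nonneg (h _) (Nat.cast_nonneg _), by rw [hf.sum_symLift, h1]⟩

theorem feasible_reducedDist (hf : IsReduction f) {π : Sp n → ℝ} (hπ : IsProb π)
    (h : PauliMixing π) : (designLP f).Feasible (reducedDist f π) := by
  classical
  have hne : ∀ z : NZ n, (Sum.elim 0 z.1 : BitVec2 n) ≠ 0 := fun z hz =>
    z.2 (funext fun j => congrFun hz (Sum.inr j))
  refine (feasible_designLP_iff _).mpr ⟨fun r => Finset.sum_nonneg fun U _ => hπ.1 U, ?_,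
    fun z w => hf.sum_reducedDist_mul_transProb h (hne z) (hne w)⟩
  have := hf.sum_reducedDist_mul π (fun _ => 1) fun _ _ _ => rfl
  simpa [hπ.2] using this

theorem pauliMixing_symLift (hf : IsReduction f) {η : Reduced f → ℝ}
    (h : (designLP f).Feasible η) : PauliMixing (symLift f η) :=
  pauliMixing_of_cls_invariant (fun _ _ => hf.symLift_eq η) fun z w => by
    rw [← hf.sum_mul_transProb]
    exact ((feasible_designLP_iff η).mp h).2.2 z w

theorem feasible_of_design (hf : IsReduction f) {μ : Clifford n → ℝ} (h : IsClifford2Design μ) :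
    (designLP f).Feasible (reducedDist f (induced μ)) :=
  hf.feasible_reducedDist (isProb_induced h.1) h.2.pauliMixing

theorem value_of_design (hf : IsReduction f) (μ : Clifford n → ℝ) :
    (designLP f).value (reducedDist f (induced μ)) = avgCost μ := by
  rw [hf.value_reducedDist, avgCost_eq]

theorem reducedDist_induced_lift (hf : IsReduction f) (η : Reduced f → ℝ) :
    reducedDist f (induced (pauliLift (symLift f η))) = η := by
  rw [induced_pauliLift, hf.reducedDist_symLift]

theorem design_of_feasible (hf : IsReduction f) {η : Reduced f → ℝ}
    (h : (designLP f).Feasible η) : IsClifford2Design (pauliLift (symLift f η)) := by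
  obtain ⟨h0, h1, -⟩ := (feasible_designLP_iff η).mp h
  have hp := isProb_pauliLift (hf.isProb_symLift h0 h1)
  refine ⟨hp, PauliMixing.isUnitary2Design hp (pauliInvariant_pauliLift _) ?_⟩
  rw [induced_pauliLift]
  exact hf.pauliMixing_symLift h

theorem avgCost_lift (hf : IsReduction f) (η : Reduced f → ℝ) :
    avgCost (pauliLift (symLift f η)) = (designLP f).value η := by
  rw [← hf.value_of_design, hf.reducedDist_induced_lift]

/-- Any competing feasible point lifts to a design of the same cost, which cannot be below the
minimum. -/
theorem isOptimal_of_isOptimalDesign (hf : IsReduction f) {μ : Clifford n → ℝ}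
    (h : IsOptimalDesign μ) : (designLP f).IsOptimal (reducedDist f (induced μ)) :=
  ⟨hf.feasible_of_design h.1, fun ξ hξ => by
    rw [hf.value_of_design, ← hf.avgCost_lift]
    exact h.2 _ (hf.design_of_feasible hξ)⟩

/-- Lifting and then reducing returns `η`, so the converse holds for every real `η`: feasibility
follows from the lift being a design. -/
theorem isOptimal_iff (hf : IsReduction f) (η : Reduced f → ℝ) :
    (designLP f).IsOptimal η ↔ IsOptimalDesign (pauliLift (symLift f η)) := by
  constructor
  · rintro ⟨h, hopt⟩
    refine ⟨hf.design_of_feasible h, fun ν hν => ?_⟩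
    rw [hf.avgCost_lift, ← hf.value_of_design]
    exact hopt _ (hf.feasible_of_design hν)
  · intro h
    have := hf.isOptimal_of_isOptimalDesign h
    rwa [hf.reducedDist_induced_lift] at this

/-- The feasible set is closed, lies in the unit cube and contains the reduction of the uniform
distribution, so the continuous objective attains its minimum. -/
theorem exists_isOptimal (hf : IsReduction f) : ∃ η, (designLP f).IsOptimal η := by
  have hne : {η | (designLP f).Feasible η}.Nonempty :=
    ⟨_, hf.feasible_reducedDist (π := fun _ => 1 / (Fintype.card (Sp n) : ℝ))
      ⟨fun _ => by positivity, by simp⟩ (pauliMixing_uniform n)⟩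
  have hclosed : IsClosed {η | (designLP f).Feasible η} := by
    have h1 : IsClosed {η : Reduced f → ℝ | ∀ r, 0 ≤ η r} := by
      simp only [Set.ofPred_forall]
      exact isClosed_iInter fun r => isClosed_le continuous_const (continuous_apply r)
    have h2 : IsClosed {η : Reduced f → ℝ | (designLP f).A *ᵥ η = (designLP f).b} :=
      isClosed_eq (continuous_const.matrix_mulVec continuous_id) continuous_const
    exact h1.inter h2
  have hsub : {η | (designLP f).Feasible η} ⊆ Set.Icc 0 1 := fun η h => by
    obtain ⟨h0, h1, -⟩ := (feasible_designLP_iff η).mp h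
    refine ⟨h0, fun r => ?_⟩
    rw [Pi.one_apply, ← h1]
    exact Finset.single_le_sum (fun r _ => h0 r) (Finset.mem_univ r)
  have hcont : Continuous (designLP f).value :=
    Continuous.dotProduct continuous_const continuous_id
  obtain ⟨η, hη, hmin⟩ := (isCompact_Icc.of_isClosed_subset hclosed hsub).exists_isMinOn hne
    hcont.continuousOn
  exact ⟨η, hη, fun ξ hξ => hmin hξ⟩

end IsReduction

theorem card_constraints (n : ℕ) :
    Fintype.card (Option (NZ n × NZ n)) = 1 + (2 ^ n - 1) ^ 2 := by
  have : Fintype.card (NZ n) = 2 ^ n - 1 := by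
    rw [Fintype.card_subtype_compl, Fintype.card_subtype_eq]
    simp [ZMod.card]
  rw [Fintype.card_option, Fintype.card_prod, this]
  ring

end CliffordDesign

theorem mainTheorem7 (n : ℕ) :
    -- A Pauli-invariant distribution is a 2-design iff the induced distribution is Pauli mixing.
    (∀ μ : Clifford n → ℝ, IsProb μ → PauliInvariant μ →
      IsProb (induced μ) ∧
      (∀ q : Clifford n, induced μ (tableau q) = 4 ^ n * μ q) ∧
      (IsUnitary2Design Clifford.rep μ ↔ PauliMixing (induced μ)) ∧
      avgCost μ = avgCostSp (induced μ)) ∧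
    -- Every distribution on the symplectic group is induced by a Pauli-invariant one.
    (∀ π : Sp n → ℝ, IsProb π →
      IsProb (pauliLift π) ∧ PauliInvariant (pauliLift π) ∧ induced (pauliLift π) = π) ∧
    -- Reduction of minimum-average-cost Clifford 2-designs to the linear program.
    (∀ f : Sp n → Sp n, IsReduction f →
      Fintype.card (Option (NZ n × NZ n)) = 1 + (2 ^ n - 1) ^ 2 ∧
      (∀ π : Sp n → ℝ, IsProb π → (∀ U V : Sp n, V ∈ cls U → π V = π U) →
        symLift f (reducedDist f π) = π ∧
        (PauliMixing π ↔ (designLP f).Feasible (reducedDist f π))) ∧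
      (∀ μ : Clifford n → ℝ, IsClifford2Design μ →
        (designLP f).Feasible (reducedDist f (induced μ)) ∧
        (designLP f).value (reducedDist f (induced μ)) = avgCost μ) ∧
      (∀ η : Reduced f → ℝ, (designLP f).Feasible η →
        IsClifford2Design (pauliLift (symLift f η)) ∧
        PauliInvariant (pauliLift (symLift f η)) ∧
        reducedDist f (symLift f η) = η ∧
        avgCost (pauliLift (symLift f η)) = (designLP f).value η) ∧
      (∀ μ : Clifford n → ℝ, IsOptimalDesign μ →
        (designLP f).IsOptimal (reducedDist f (induced μ))) ∧
      (∀ η : Reduced f → ℝ,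
        (designLP f).IsOptimal η ↔ IsOptimalDesign (pauliLift (symLift f η))) ∧
      ∃ η : Reduced f → ℝ, (designLP f).IsOptimal η) := by
  refine ⟨fun μ hμ hP => ⟨isProb_induced hμ, induced_tableau hP,
    ⟨fun h => h.pauliMixing, fun h => h.isUnitary2Design hμ hP⟩, avgCost_eq μ⟩,
    fun π hπ => ⟨isProb_pauliLift hπ, pauliInvariant_pauliLift π, induced_pauliLift π⟩,
    fun f hf => ⟨card_constraints n, fun π hπ hc => ?_,
      fun μ hμ => ⟨hf.feasible_of_design hμ, hf.value_of_design μ⟩,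
      fun η hη => ⟨hf.design_of_feasible hη, pauliInvariant_pauliLift _,
        hf.reducedDist_symLift η, hf.avgCost_lift η⟩,
      fun μ hμ => hf.isOptimal_of_isOptimalDesign hμ, hf.isOptimal_iff, hf.exists_isOptimal⟩⟩
  have hs := hf.symLift_reducedDist hc
  refine ⟨hs, hf.feasible_reducedDist hπ, fun h => ?_⟩
  rw [← hs]
  exact hf.pauliMixing_symLift h
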